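/- In the set cover problem we are given a set system: a universe $\mathcal U$ of $N$ elements and a family $\mathcal S$ of $m$ subsets covering $\mathcal U$, with nonnegative rational costs $c$. In the online-with-a-sample setting with parameter $\alpha\in(0,1]$, an adversary fixes the set system and an unknown element set $U\subseteq\mathcal U$ with $|U|=n$. The algorithm is given the set system and a uniformly random subset $W\subseteq U$ of size $\alpha n$ (rounded either down or up if $\alpha n$ is not an integer), but neither $U$ nor $n$; the remaining elements of $U$ then arrive one by one in adversarial order, and each must be covered immediately and irrevocably on arrival. A (randomized) universal algorithm determines from the set system, $W$ and its random bits alone, before any further element arrives, a map $\mathfrak S:\mathcal U\to\mathcal S$ with $u\in\mathfrak S(u)$ for every $u\in\mathcal U$; when $u$ arrives it buys $\mathfrak S(u)$ if it does not own this set yet. The total cost, whatever the arrival order and including the sets bought for the sampled elements, is $c(\mathfrak S(U))$ with $\mathfrak S(U)=\{\mathfrak S(u):u\in U\}$. Let $\mathrm{opt}(U)$ be the minimum cost of a subfamily of $\mathcal S$ that covers $U$. **Theorem.** There is an absolute constant $C>0$ such that for every $0<\alpha\le 1$ there is a universal algorithm for online-with-a-sample set cover which 1. runs in polynomial time: on a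 random access machine with logarithmic cost it computes the whole map $\mathfrak S$ from an explicit description of the set system (incidence matrix, and costs as fractions in binary), the sample $W$ and polynomially many fair random bits, in time polynomial in the length of the description of the set system, for every outcome of the random bits; and 2. is $O(\log(mn)/\alpha)$-competitive: for every set system and every $U\subseteq\mathcal U$ with $|U|=n$, $$\mathbb E\big[c(\mathfrak S(U))\big]\;\le\;\frac{C\,\max\{1,\log(mn)\}}{\alpha}\cdot \mathrm{opt}(U),$$ where the expectation is over the sample $W$ and the random bits (and $\log 0:=0$ when $mn=0$). -/

import Mathlib

open scoped BigOperators

noncomputable section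

namespace SetCover

/-! ### A sequential machine model with logarithmic cost

Programs of a random access machine over the natural numbers, in structured form. A state holds
finitely many named registers in use and finitely many named arrays in use, all entries being
natural numbers. Every value that is computed, read or written is charged its binary length, so
that running times are polynomially related to those of Turing machines. -/

/-- The content of the memory: `reg x` is register `x`, and `arr a j` is entry `j` of array `a`. -/
structure State where
  reg : ℕ → ℕ
  arr : ℕ → ℕ → ℕ

/-- Elementary operations: arithmetic with truncated subtraction, division with remainder
(`x / 0 = 0`, `x % 0 = x`), and comparisons with values `0` and `1`. -/
inductive BinOp
  | add | sub | mul | div | mod | lt | eq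

def BinOp.eval : BinOp → ℕ → ℕ → ℕ
  | .add, x, y => x + y
  | .sub, x, y => x - y
  | .mul, x, y => x * y
  | .div, x, y => x / y
  | .mod, x, y => x % y
  | .lt, x, y => if x < y then 1 else 0
  | .eq, x, y => if x = y then 1 else 0

/-- Expressions: constants, registers, array entries `arr a e`, elementary operations. -/
inductive Expr
  | lit (n : ℕ)
  | reg (x : ℕ)
  | get (a : ℕ) (e : Expr)
  | bin (op : BinOp) (e₁ e₂ : Expr)

def Expr.eval (σ : State) : Expr → ℕ
  | .lit n => n
  | .reg x => σ.reg x
  | .get a e => σ.arr a (e.eval σ)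
  | .bin op e₁ e₂ => op.eval (e₁.eval σ) (e₂.eval σ)

/-- The time for evaluating an expression: one unit, plus the binary length of the value, for
each of its nodes. -/
def Expr.time (σ : State) : Expr → ℕ
  | .lit n => 1 + Nat.size n
  | .reg x => 1 + Nat.size (σ.reg x)
  | .get a e => e.time σ + 1 + Nat.size ((Expr.get a e).eval σ)
  | .bin op e₁ e₂ => e₁.time σ + e₂.time σ + 1 + Nat.size ((Expr.bin op e₁ e₂).eval σ)

/-- Programs. -/
inductive Program
  | assign (x : ℕ) (e : Expr)
  | put (a : ℕ) (i e : Expr)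
  | seq (c₁ c₂ : Program)
  | cond (e : Expr) (c₁ c₂ : Program)
  | loop (e : Expr) (c : Program)

/-- The register assignment `x := v`. -/
def State.setReg (σ : State) (x v : ℕ) : State :=
  ⟨Function.update σ.reg x v, σ.arr⟩

/-- The array assignment `a[j] := v`. -/
def State.setArr (σ : State) (a j v : ℕ) : State :=
  ⟨σ.reg, Function.update σ.arr a (Function.update (σ.arr a) j v)⟩

/-- `Exec c σ t τ`: the program `c`, started in the state `σ`, halts in the state `τ` after time
`t`. The rules are deterministic: `c` and `σ` determine `t` and `τ`. A `loop` is a while loop,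
and any nonzero value of a condition means "true". -/
inductive Exec : Program → State → ℕ → State → Prop
  | assign (σ : State) (x : ℕ) (e : Expr) :
      Exec (.assign x e) σ (1 + e.time σ) (σ.setReg x (e.eval σ))
  | put (σ : State) (a : ℕ) (i e : Expr) :
      Exec (.put a i e) σ (1 + i.time σ + e.time σ) (σ.setArr a (i.eval σ) (e.eval σ))
  | seq {c₁ c₂ : Program} {σ₁ σ₂ σ₃ : State} {t₁ t₂ : ℕ} :
      Exec c₁ σ₁ t₁ σ₂ → Exec c₂ σ₂ t₂ σ₃ → Exec (.seq c₁ c₂) σ₁ (t₁ + t₂) σ₃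
  | condTrue {e : Expr} {c₁ c₂ : Program} {σ τ : State} {t : ℕ} :
      e.eval σ ≠ 0 → Exec c₁ σ t τ → Exec (.cond e c₁ c₂) σ (1 + e.time σ + t) τ
  | condFalse {e : Expr} {c₁ c₂ : Program} {σ τ : State} {t : ℕ} :
      e.eval σ = 0 → Exec c₂ σ t τ → Exec (.cond e c₁ c₂) σ (1 + e.time σ + t) τ
  | loopTrue {e : Expr} {c : Program} {σ₁ σ₂ σ₃ : State} {t₁ t₂ : ℕ} :
      e.eval σ₁ ≠ 0 → Exec c σ₁ t₁ σ₂ → Exec (.loop e c) σ₂ t₂ σ₃ →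
        Exec (.loop e c) σ₁ (1 + e.time σ₁ + t₁ + t₂) σ₃
  | loopFalse {e : Expr} {c : Program} {σ : State} :
      e.eval σ = 0 → Exec (.loop e c) σ (1 + e.time σ) σ

/-! ### Set cover -/

/-- A weighted set system: a universe of `N` elements and a family of `m` subsets with
nonnegative rational costs that cover the universe. -/
structure SetSystem where
  N : ℕ
  m : ℕ
  sets : Fin m → Finset (Fin N)
  cost : Fin m → ℚ≥0
  covers : ∀ u : Fin N, ∃ i : Fin m, u ∈ sets i

namespace SetSystem

variable (I : SetSystem)

/-- The length of an explicit description of the system: the incidence matrix, and the costs as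
fractions in binary. -/
def size : ℕ :=
  I.N + I.m + I.N * I.m + ∑ i, (Nat.size (I.cost i).num + Nat.size (I.cost i).den)

/-- The total cost of a subcollection. -/
def totalCost (T : Finset (Fin I.m)) : ℝ := ∑ i ∈ T, (I.cost i : ℝ)

/-- The subcollections that cover `U`. -/
def solutions (U : Finset (Fin I.N)) : Finset (Finset (Fin I.m)) :=
  {T | ∀ u ∈ U, ∃ i ∈ T, u ∈ I.sets i}

theorem solutions_nonempty (U : Finset (Fin I.N)) : (I.solutions U).Nonempty :=
  ⟨Finset.univ, by simpa [solutions] using fun u _ => I.covers u⟩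

/-- The minimum cost of a subcollection that covers `U`. -/
def opt (U : Finset (Fin I.N)) : ℝ :=
  (I.solutions U).inf' (I.solutions_nonempty U) I.totalCost

open Classical in
/-- The initial memory of a machine that is given the set system, a set `W` of elements and the
string `ω` of random bits. Registers `0` and `1` hold `N` and `m`; array `0` holds the incidence
matrix (row by row, one row for each set), arrays `1` and `2` the numerators and denominators of
the costs, array `3` the indicator vector of `W`, and array `4` the random bits. Everything else
is `0`. -/
def input (W : Finset (Fin I.N)) {r : ℕ} (ω : Fin r → Bool) : State where
  reg
    | 0 => I.N
    | 1 => I.m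
    | _ => 0
  arr
    | 0, j => if ∃ (i : Fin I.m) (u : Fin I.N), j = i * I.N + u ∧ u ∈ I.sets i then 1 else 0
    | 1, j => if h : j < I.m then (I.cost ⟨j, h⟩).num else 0
    | 2, j => if h : j < I.m then (I.cost ⟨j, h⟩).den else 0
    | 3, j => if ∃ u ∈ W, j = (u : ℕ) then 1 else 0
    | 4, j => if h : j < r then (ω ⟨j, h⟩).toNat else 0
    | _, _ => 0

end SetSystem

/-! ### Universal algorithms in the online-with-a-sample setting -/

/-- A randomized universal algorithm. From the set system, the revealed sample `W` and a string
of random bits, whose length is a polynomial in the size of the set system, it determines a map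
that takes each element of the universe to a set containing it. The map is fixed before any of the
remaining elements arrives. Whatever the order of arrival, the set assigned to an element is bought
when the element arrives, if it has not been bought before. -/
structure UniversalAlgorithm where
  coins : Polynomial ℕ
  map : (I : SetSystem) → (W : Finset (Fin I.N)) → (Fin (coins.eval I.size) → Bool) →
    Fin I.N → Fin I.m
  mem_map : ∀ (I : SetSystem) (W : Finset (Fin I.N)) (ω : Fin (coins.eval I.size) → Bool) (u : Fin I.N),
    u ∈ I.sets (map I W ω u)

namespace UniversalAlgorithm

variable (A : UniversalAlgorithm)

/-- One program computes the map (as array `5`) from the set system, the sample and the random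
bits, in time polynomial in the size of the set system, for every outcome of the random bits. -/
def PolyTime : Prop :=
  ∃ (c : Program) (p : Polynomial ℕ), ∀ (I : SetSystem) (W : Finset (Fin I.N))
    (ω : Fin (A.coins.eval I.size) → Bool), ∃ (t : ℕ) (τ : State),
    Exec c (I.input W ω) t τ ∧ t ≤ p.eval I.size ∧ 
      ∀ u : Fin I.N, τ.arr 5 (u : ℕ) = (A.map I W ω u : ℕ)

/-- The expected cost of the sets bought for the elements of `U`, when the sample is a uniformly
random subset of `U` with `k` elements. -/
def expectedCost (I : SetSystem) (U : Finset (Fin I.N)) (k : ℕ) : ℝ :=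
  𝔼 W ∈ U.powersetCard k, 𝔼 ω : Fin (A.coins.eval I.size) → Bool,
    I.totalCost (U.image (A.map I W ω))

/-- `A` is `ρ`-competitive with an `α`-fraction as the sample, where `ρ` may depend on the number
of sets and on the number of elements that the adversary selects. If `α * n` is not an integer,
both ways of rounding it are allowed. -/
def Competitive (α : ℝ) (ρ : ℕ → ℕ → ℝ) : Prop :=
  ∀ (I : SetSystem) (U : Finset (Fin I.N)) (k : ℕ),
    k = ⌊α * U.card⌋₊ ∨ k = ⌈α * U.card⌉₊ →
      A.expectedCost I U k ≤ ρ I.m U.card * I.opt U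

end UniversalAlgorithm

end SetCover

end

/-! The algorithm learns a fractional cover from the sample by multiplicative weights, rounds it
with boosted probabilities, and gives every element that is still uncovered its cheapest set, of
cost `κ u`.

Learning. Let `β` be a guess of the optimum. Weights `w i` encode the fractional collection `x i = β
* w i / (c i * total)` of cost at most `β`. An element is bad if `κ u > β / k` and its coverage, up
to rounding, is at most 1/8. While the sample contains a bad element, the first one is a mistake:
the weights of its sets grow by a factor of about `1 + κ u / c i`. If `κ u > β`, or if the mistakes
with this guess cost more than `8 * β * L`, the guess is at least doubled and the weights start
anew. Comparing the total weight with the weights in a cover `T` (`Problem.Inv.mistakes_le`,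
`Problem.Inv.update`) shows that the cost bound is never exceeded while `β` is at least the price of
`T`. Hence `β` is at most twice the optimum, and all mistakes of a run together cost O(L) times the
optimum (`Problem.history`), where L is O(log(mn)).

Generalization. The run depends on the sample only through the mistakes. If `v` is never a mistake
in the run on `R`, then the run on `R.erase v` is the same and `v` is not bad at its end
(`Problem.final_erase`). So the elements that are bad when left out cost at most as much as the
mistakes (`Problem.sum_bad_erase_le`). A random sample of size `k` with one more random element is a
random sample of size `k + 1` with a distinguished element (`expect_sum_sdiff_le`), so the bad
elements outside the sample cost O(L/α) times the optimum in expectation.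

Rounding. Set `i` is chosen with probability about `min 1 (8 * L * x i)`, at expected total cost O(L
β). An element with `κ u ≤ β / k` pays at most `β / k`, a bad one pays at most `κ u`, and any other
one is missed with probability at most `1 / k` (`Problem.expect_price_assign_le`). With n/k = O(1/α)
everything adds up.

Running time. Everything is integer arithmetic with floors. Each step is a loop-free command built
from bounded sums and products, which compiles to a polynomial-time program (`Cmd.exists_exec`). One
while loop iterates it, and the mistake bound limits both the number of rounds and the lengths of
the numbers. -/

namespace SetCover

/-! ### Expressions with bounded sums and products -/

/-- Expressions over the memory: literals, the two dimensions (registers `0` and `1`), variables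
(register `y + 2` holds variable `y`), bound variables (de Bruijn indices), array entries,
elementary operations, and sums and products over all indices below a dimension. -/
inductive Term
  | lit (n : ℕ)
  | dim (n : Fin 2)
  | reg (y : Fin 14)
  | var (i : ℕ)
  | get (a : ℕ) (e : Term)
  | bin (op : BinOp) (e₁ e₂ : Term)
  | sum (n : Fin 2) (e : Term)
  | prod (n : Fin 2) (e : Term)

namespace Term

def eval (σ : State) : List ℕ → Term → ℕ
  | _, lit n => n
  | _, dim n => σ.reg n
  | _, reg y => σ.reg (y + 2)
  | ρ, var i => ρ[i]?.getD 0
  | ρ, get a e => σ.arr a (e.eval σ ρ)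
  | ρ, bin op e₁ e₂ => op.eval (e₁.eval σ ρ) (e₂.eval σ ρ)
  | ρ, sum n e => ∑ j ∈ Finset.range (σ.reg n), e.eval σ (j :: ρ)
  | ρ, prod n e => ∏ j ∈ Finset.range (σ.reg n), e.eval σ (j :: ρ)

/-- The program that computes the operation-fold of the values of the program `body` over the
values of the counter `d + 1` below register `n`, in register `d`. -/
def foldProgram (op : BinOp) (start : ℕ) (n d : ℕ) (body : Program) : Program :=
  .seq (.assign d (.lit start)) <| .seq (.assign (d + 1) (.lit 0)) <|
    .loop (.bin .lt (.reg (d + 1)) (.reg n)) <|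
      .seq body <| .seq (.assign d (.bin op (.reg d) (.reg (d + 2))))
        (.assign (d + 1) (.bin .add (.reg (d + 1)) (.lit 1)))

/-- A program that evaluates a term into register `d`, where `Γ` lists the registers that hold the
bound variables. Only registers from `d` on are written. -/
def compile : List ℕ → ℕ → Term → Program
  | _, d, lit n => .assign d (.lit n)
  | _, d, dim n => .assign d (.reg n)
  | _, d, reg y => .assign d (.reg (y + 2))
  | Γ, d, var i => .assign d ((Γ[i]?.map Expr.reg).getD (.lit 0))
  | Γ, d, get a e => .seq (e.compile Γ d) (.assign d (.get a (.reg d)))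
  | Γ, d, bin op e₁ e₂ => .seq (e₁.compile Γ d) <| .seq (e₂.compile Γ (d + 1)) <|
      .assign d (.bin op (.reg d) (.reg (d + 1)))
  | Γ, d, sum n e => foldProgram .add 0 n d (e.compile ((d + 1) :: Γ) (d + 2))
  | Γ, d, prod n e => foldProgram .mul 1 n d (e.compile ((d + 1) :: Γ) (d + 2))

/-- The term does not read the array `a`. -/
def Avoids (a : ℕ) : Term → Prop
  | lit _ | dim _ | reg _ | var _ => True
  | get a' e => a' ≠ a ∧ e.Avoids a
  | bin _ e₁ e₂ => e₁.Avoids a ∧ e₂.Avoids a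
  | sum _ e | prod _ e => e.Avoids a

end Term

/-- The memory outside the scratch registers coincides. -/
def Agree (σ τ : State) : Prop := τ.arr = σ.arr ∧ ∀ r < 16, τ.reg r = σ.reg r

/-- All entries of the memory outside the scratch registers have binary length at most `b`, and
the dimensions themselves are at most `b`. -/
structure Bounded (b : ℕ) (σ : State) : Prop where
  dim : ∀ n : Fin 2, σ.reg n ≤ b
  reg : ∀ r < 16, Nat.size (σ.reg r) ≤ b
  arr : ∀ a j, Nat.size (σ.arr a j) ≤ b

theorem Agree.refl (σ : State) : Agree σ σ := ⟨rfl, fun _ _ => rfl⟩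

theorem Bounded.mono {b b' : ℕ} {σ : State} (h : Bounded b σ) (hb : b ≤ b') : Bounded b' σ :=
  ⟨fun n => (h.dim n).trans hb, fun r hr => (h.reg r hr).trans hb, fun a j => (h.arr a j).trans hb⟩

theorem Bounded.congr {b : ℕ} {σ τ : State} (h : Bounded b σ) (e : Agree σ τ) : Bounded b τ := by
  refine ⟨fun n => ?_, fun r hr => ?_, fun a j => ?_⟩
  · rw [e.2 n (by omega)]; exact h.dim n
  · rw [e.2 r hr]; exact h.reg r hr
  · rw [e.1]; exact h.arr a j

/-- This makes array assignments sound: the entries written so far do not affect the values still to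
be computed. -/
theorem Term.eval_congr {σ τ : State} {a : ℕ} (hr : ∀ r < 16, τ.reg r = σ.reg r)
    (ha : ∀ a' ≠ a, τ.arr a' = σ.arr a') {e : Term} (h : e.Avoids a) (ρ : List ℕ) :
    e.eval τ ρ = e.eval σ ρ := by
  induction e generalizing ρ with
  | lit n => rfl
  | dim n => exact hr n (by omega)
  | reg y => exact hr (y + 2) (by omega)
  | var i => rfl
  | get a' e ih => simp only [Term.eval, ih h.2, ha a' h.1]
  | bin op e₁ e₂ ih₁ ih₂ => simp only [Term.eval, ih₁ h.1, ih₂ h.2]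
  | sum n e ih =>
    simp only [Term.eval, hr n (by omega)]
    exact Finset.sum_congr rfl fun j _ => ih h _
  | prod n e ih =>
    simp only [Term.eval, hr n (by omega)]
    exact Finset.prod_congr rfl fun j _ => ih h _

theorem Term.eval_agree {σ τ : State} (h : Agree σ τ) (e : Term) (ρ : List ℕ) :
    e.eval τ ρ = e.eval σ ρ := by
  induction e generalizing ρ with
  | lit n => rfl
  | dim n => exact h.2 n (by omega)
  | reg y => exact h.2 (y + 2) (by omega)
  | var i => rfl
  | get a' e ih => simp only [Term.eval, ih, h.1]
  | bin op e₁ e₂ ih₁ ih₂ => simp only [Term.eval, ih₁, ih₂]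
  | sum n e ih =>
    simp only [Term.eval, h.2 n (by omega)]
    exact Finset.sum_congr rfl fun j _ => ih _
  | prod n e ih =>
    simp only [Term.eval, h.2 n (by omega)]
    exact Finset.prod_congr rfl fun j _ => ih _

/-! ### Binary lengths -/

theorem size_le_self (n : ℕ) : Nat.size n ≤ n := Nat.size_le.2 n.lt_two_pow_self

theorem size_add_le (x y : ℕ) : Nat.size (x + y) ≤ Nat.size x + Nat.size y + 1 := by
  rw [Nat.size_le]
  have hx := Nat.lt_size_self x
  have hy := Nat.lt_size_self y
  have h1 : 2 ^ x.size ≤ 2 ^ (x.size + y.size) := Nat.pow_le_pow_right (by norm_num) (by omega)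
  have h2 : 2 ^ y.size ≤ 2 ^ (x.size + y.size) := Nat.pow_le_pow_right (by norm_num) (by omega)
  rw [pow_succ]; omega

theorem size_mul_le (x y : ℕ) : Nat.size (x * y) ≤ Nat.size x + Nat.size y := by
  rw [Nat.size_le, pow_add]
  exact Nat.mul_lt_mul'' (Nat.lt_size_self x) (Nat.lt_size_self y)

theorem size_eval_le (op : BinOp) (x y : ℕ) :
    Nat.size (op.eval x y) ≤ Nat.size x + Nat.size y + 1 := by
  cases op
  · exact size_add_le x y
  · exact (Nat.size_le_size (Nat.sub_le x y)).trans (by omega)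
  · exact (size_mul_le x y).trans (by omega)
  · exact (Nat.size_le_size (Nat.div_le_self x y)).trans (by omega)
  · exact (Nat.size_le_size (Nat.mod_le x y)).trans (by omega)
  all_goals
    have h : (if x < y then 1 else 0) ≤ 1 ∧ (if x = y then 1 else 0) ≤ 1 := by
      constructor <;> split_ifs <;> simp
    simp only [BinOp.eval]
    exact (size_le_self _).trans (by omega)

theorem size_sum_le {n b p : ℕ} (hn : n ≤ b) {f : ℕ → ℕ} (h : ∀ j < n, Nat.size (f j) ≤ p) :
    Nat.size (∑ j ∈ Finset.range n, f j) ≤ b + p := by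
  rw [Nat.size_le, pow_add]
  have h1 : ∑ j ∈ Finset.range n, f j ≤ n * 2 ^ p := by
    simpa using Finset.sum_le_card_nsmul (Finset.range n) f (2 ^ p) fun j hj =>
      (Nat.size_le.1 (h j (Finset.mem_range.1 hj))).le
  have h2 : n < 2 ^ b := hn.trans_lt b.lt_two_pow_self
  exact h1.trans_lt (Nat.mul_lt_mul_of_pos_right h2 (by positivity))

theorem size_prod_le {n b p : ℕ} (hn : n ≤ b) {f : ℕ → ℕ} (h : ∀ j < n, Nat.size (f j) ≤ p) :
    Nat.size (∏ j ∈ Finset.range n, f j) ≤ b * p + 1 := by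
  rw [Nat.size_le]
  have h1 : ∏ j ∈ Finset.range n, f j ≤ (2 ^ p) ^ n := by
    simpa using Finset.prod_le_pow_card (Finset.range n) f (2 ^ p) fun j hj =>
      (Nat.size_le.1 (h j (Finset.mem_range.1 hj))).le
  refine h1.trans_lt ?_
  rw [← pow_mul]
  exact Nat.pow_lt_pow_right (by norm_num) (by nlinarith)

open Polynomial in
-- Since `Bounded` limits the dimensions themselves and not only their lengths, a sum adds at most
-- `b` bits and a product multiplies the length by about `b`. So every constructor acts polynomially
-- on the bound.
theorem Term.exists_size_le (e : Term) : ∃ p : ℕ[X], ∀ (b : ℕ) (σ : State) (ρ : List ℕ),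
    Bounded b σ → (∀ x ∈ ρ, Nat.size x ≤ b) → Nat.size (e.eval σ ρ) ≤ p.eval b := by
  induction e with
  | lit n => exact ⟨C n, fun b σ ρ _ _ => by simpa [Term.eval] using size_le_self n⟩
  | dim n => exact ⟨X, fun b σ ρ h _ => by simpa [Term.eval] using h.reg n (by omega)⟩
  | reg y => exact ⟨X, fun b σ ρ h _ => by simpa [Term.eval] using h.reg (y + 2) (by omega)⟩
  | var i =>
    refine ⟨X, fun b σ ρ h hρ => ?_⟩
    simp only [Term.eval, eval_X]
    rcases hx : ρ[i]? with _ | x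
    · simp
    · exact hρ x (List.mem_of_getElem? hx)
  | get a e ih => exact ⟨X, fun b σ ρ h _ => by simpa [Term.eval] using h.arr a _⟩
  | bin op e₁ e₂ ih₁ ih₂ =>
    obtain ⟨p₁, h₁⟩ := ih₁
    obtain ⟨p₂, h₂⟩ := ih₂
    refine ⟨p₁ + p₂ + 1, fun b σ ρ h hρ => (size_eval_le op _ _).trans ?_⟩
    simpa using add_le_add (h₁ b σ ρ h hρ) (h₂ b σ ρ h hρ)
  | sum n e ih =>
    obtain ⟨p, hp⟩ := ih
    refine ⟨X + p, fun b σ ρ h hρ => ?_⟩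
    rw [eval_add, eval_X]
    refine size_sum_le (h.dim n) fun j hj => hp b σ _ h ?_
    have := h.dim n
    simpa using ⟨(size_le_self j).trans (by omega), hρ⟩
  | prod n e ih =>
    obtain ⟨p, hp⟩ := ih
    refine ⟨X * p + 1, fun b σ ρ h hρ => ?_⟩
    rw [eval_add, eval_mul, eval_X, eval_one]
    refine size_prod_le (h.dim n) fun j hj => hp b σ _ h ?_
    have := h.dim n
    simpa using ⟨(size_le_self j).trans (by omega), hρ⟩

/-! ### Running programs -/

/-- The invariant is indexed by the number of completed rounds. The condition is tested `T + 1`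
times, the last time with result 0. -/
theorem exec_loop {e : Expr} {c : Program} (I : ℕ → State → Prop) (T q q' : ℕ)
    (ht : ∀ j ≤ T, ∀ σ, I j σ → e.time σ ≤ q)
    (hstep : ∀ j < T, ∀ σ, I j σ → e.eval σ ≠ 0 ∧ ∃ t τ, Exec c σ t τ ∧ t ≤ q' ∧ I (j + 1) τ)
    (hend : ∀ σ, I T σ → e.eval σ = 0) {σ : State} (hσ : I 0 σ) :
    ∃ t τ, Exec (.loop e c) σ t τ ∧ t ≤ (T + 1) * (1 + q + q') ∧ I T τ := by
  suffices H : ∀ k j, j + k = T → ∀ σ, I j σ →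
      ∃ t τ, Exec (.loop e c) σ t τ ∧ t ≤ (k + 1) * (1 + q + q') ∧ I T τ from
    H T 0 (zero_add T) σ hσ
  intro k
  induction k with
  | zero =>
    rintro j rfl σ hσ
    exact ⟨_, σ, .loopFalse (hend σ hσ), by have := ht j le_rfl σ hσ; omega, hσ⟩
  | succ k ih =>
    rintro j hj σ hσ
    obtain ⟨h0, t₁, σ₁, h1, ht1, hI⟩ := hstep j (by omega) σ hσ
    obtain ⟨t₂, τ, h2, ht2, hT⟩ := ih (j + 1) (by omega) σ₁ hI
    refine ⟨_, τ, .loopTrue h0 h1 h2, ?_, hT⟩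
    have := ht j (by omega) σ hσ
    rw [add_one_mul]
    omega

/-- What a program does that evaluates a term into register `d`: it reaches a state that differs
only in registers from `d` on and holds the value `v` in register `d`. -/
def Yields (c : Program) (σ : State) (d q v : ℕ) : Prop :=
  ∃ t τ, Exec c σ t τ ∧ t ≤ q ∧ τ.arr = σ.arr ∧ (∀ r < d, τ.reg r = σ.reg r) ∧ τ.reg d = v

/-- `acc j` is the accumulator after `j` rounds. The body writes only from register `d + 2` on, so
the accumulator in `d` and the counter in `d + 1` survive it. -/
theorem yields_foldProgram {op : BinOp} {start n d b p q : ℕ} {body : Program} {σ : State}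
    {f acc : ℕ → ℕ} (hnd : n < d) (hn : σ.reg n ≤ b) (h0 : acc 0 = start)
    (hacc : ∀ j, acc (j + 1) = op.eval (acc j) (f j))
    (hp : ∀ j ≤ σ.reg n, Nat.size (acc j) ≤ p) (hf : ∀ j < σ.reg n, Nat.size (f j) ≤ p)
    (hbody : ∀ j < σ.reg n, ∀ τ : State, τ.arr = σ.arr → (∀ r < d, τ.reg r = σ.reg r) →
      τ.reg (d + 1) = j → Yields body τ (d + 2) q (f j)) :
    Yields (Term.foldProgram op start n d body) σ d
      (10 + p + (b + 1) * (20 + 6 * b + 3 * p + q)) (acc (σ.reg n)) := by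
  let I : ℕ → State → Prop := fun j τ =>
    τ.arr = σ.arr ∧ (∀ r < d, τ.reg r = σ.reg r) ∧ τ.reg d = acc j ∧ τ.reg (d + 1) = j
  have hs : Nat.size (σ.reg n) ≤ b := (size_le_self _).trans hn
  have hsize : ∀ j ≤ σ.reg n, Nat.size j ≤ b := fun j hj => (size_le_self j).trans (by omega)
  have s0 : Nat.size 0 = 0 := by simp
  have s1 : Nat.size 1 = 1 := by simp
  have slt : ∀ x y : ℕ, Nat.size (if x < y then 1 else 0) ≤ 1 := by
    intro x y; split_ifs <;> simp
  have key := exec_loop (e := .bin .lt (.reg (d + 1)) (.reg n))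
    (c := .seq body <| .seq (.assign d (.bin op (.reg d) (.reg (d + 2))))
        (.assign (d + 1) (.bin .add (.reg (d + 1)) (.lit 1)))) I (σ.reg n) (4 + 2 * b)
    (q + (4 + 3 * p) + (8 + 2 * b)) ?_ ?_ ?_
    (σ := (σ.setReg d start).setReg (d + 1) 0) ?_
  · obtain ⟨t, τ, h1, h2, h3, h4, h5, h6⟩ := key
    refine ⟨_, τ, .seq (.assign _ _ _) (.seq (.assign _ _ _) h1), ?_, h3, h4, h5⟩
    simp only [Expr.time, s0]
    have : Nat.size start ≤ p := h0 ▸ hp 0 (Nat.zero_le _)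
    have h7 : (σ.reg n + 1) * (1 + (4 + 2 * b) + (q + (4 + 3 * p) + (8 + 2 * b)))
        ≤ (b + 1) * (20 + 6 * b + 3 * p + q) := Nat.mul_le_mul (by omega) (by omega)
    omega
  · rintro j hj τ ⟨h1, h2, h3, h4⟩
    simp only [Expr.time, Expr.eval, BinOp.eval, h4, h2 n hnd]
    have := hsize j hj
    have := slt j (σ.reg n)
    omega
  · rintro j hj τ ⟨h1, h2, h3, h4⟩
    refine ⟨by simp [Expr.eval, BinOp.eval, h4, h2 n hnd, hj], ?_⟩
    obtain ⟨t, υ, g1, g2, g3, g4, g5⟩ := hbody j hj τ h1 h2 h4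
    refine ⟨_, _, .seq g1 (.seq (.assign _ _ _) (.assign _ _ _)), ?_, ?_, ?_, ?_, ?_⟩
    · have e1 : υ.reg d = acc j := by rw [g4 d (by omega), h3]
      have e2 : υ.reg (d + 1) = j := by rw [g4 (d + 1) (by omega), h4]
      simp only [Expr.time, Expr.eval, State.setReg, e1, g5, e2, s1, ← hacc,
        Function.update_of_ne (show d + 1 ≠ d by omega)]
      simp only [BinOp.eval]
      have := hp j hj.le
      have := hp (j + 1) hj
      have := hf j hj
      have := hsize j hj.le
      have := hsize (j + 1) hj
      omega
    · simp [State.setReg, g3, h1]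
    · intro r hr
      simp only [State.setReg]
      rw [Function.update_of_ne (by omega), Function.update_of_ne (by omega), g4 r (by omega),
        h2 r hr]
    · simp only [State.setReg]
      rw [Function.update_of_ne (by omega), Function.update_self]
      simp only [Expr.eval, g5, hacc, g4 d (by omega), h3]
    · simp only [State.setReg, Function.update_self, Expr.eval, BinOp.eval]
      rw [Function.update_of_ne (by omega), g4 (d + 1) (by omega), h4]
  · rintro τ ⟨h1, h2, h3, h4⟩
    simp [Expr.eval, BinOp.eval, h4, h2 n hnd]
  · refine ⟨rfl, fun r hr => ?_, ?_, ?_⟩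
    · simp only [State.setReg]
      rw [Function.update_of_ne (by omega), Function.update_of_ne (by omega)]
    · simp [State.setReg, h0]
    · simp [State.setReg]

theorem yields_assign {σ : State} {d q v : ℕ} {e : Expr} (hv : e.eval σ = v)
    (ht : 1 + e.time σ ≤ q) : Yields (.assign d e) σ d q v :=
  ⟨_, _, .assign σ d e, ht, rfl, fun r hr => by simp [State.setReg, hr.ne], by
    simp [State.setReg, hv]⟩

open Polynomial in
-- Registers from `d` on serve as a stack: the bound variables lie below `d`, and a second operand
-- is evaluated from `d + 1` on, so that neither they nor the first operand are overwritten.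
theorem Term.exists_yields (e : Term) : ∃ p : ℕ[X], ∀ (b : ℕ) (σ : State) (Γ : List ℕ) (d : ℕ),
    16 ≤ d → Bounded b σ → (∀ r ∈ Γ, r < d) → (∀ r ∈ Γ, Nat.size (σ.reg r) ≤ b) →
    Yields (e.compile Γ d) σ d (p.eval b) (e.eval σ (Γ.map σ.reg)) := by
  induction e with
  | lit n =>
    refine ⟨C (2 + n), fun b σ Γ d _ _ _ _ => yields_assign rfl ?_⟩
    have := size_le_self n
    simp only [Expr.time, eval_C]
    omega
  | dim n =>
    refine ⟨X + 2, fun b σ Γ d hd hb _ _ => yields_assign rfl ?_⟩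
    have := hb.reg n (by omega)
    simp only [Expr.time, eval_add, eval_X, eval_ofNat]
    omega
  | reg y =>
    refine ⟨X + 2, fun b σ Γ d hd hb _ _ => yields_assign rfl ?_⟩
    have := hb.reg (y + 2) (by omega)
    simp only [Expr.time, eval_add, eval_X, eval_ofNat]
    omega
  | var i =>
    refine ⟨X + 2, fun b σ Γ d hd hb _ hΓ => ?_⟩
    simp only [eval_add, eval_X, eval_ofNat]
    rcases hx : Γ[i]? with _ | x
    · exact yields_assign (by simp [Expr.eval, Term.eval, hx]) (by simp [Expr.time, hx])
    · refine yields_assign (by simp [Expr.eval, Term.eval, hx]) ?_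
      have := hΓ x (List.mem_of_getElem? hx)
      simp only [hx, Expr.time, Option.map_some, Option.getD_some]
      omega
  | get a e ih =>
    obtain ⟨p, hp⟩ := ih
    obtain ⟨s, hs⟩ := e.exists_size_le
    refine ⟨p + s + X + 3, fun b σ Γ d hd hb h1 h2 => ?_⟩
    obtain ⟨t, τ, g1, g2, g3, g4, g5⟩ := hp b σ Γ d hd hb h1 h2
    refine ⟨_, _, .seq g1 (.assign _ _ _), ?_, g3, fun r hr => ?_, ?_⟩
    · have := hs b σ (Γ.map σ.reg) hb (by simpa using h2)
      have := hb.arr a (e.eval σ (Γ.map σ.reg))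
      simp only [Expr.time, Expr.eval, g5, g3, eval_add, eval_X, eval_ofNat]
      omega
    · simp [State.setReg, hr.ne, g4 r hr]
    · simp [State.setReg, Expr.eval, Term.eval, g5, g3]
  | bin op e₁ e₂ ih₁ ih₂ =>
    obtain ⟨p₁, hp₁⟩ := ih₁
    obtain ⟨p₂, hp₂⟩ := ih₂
    obtain ⟨s₁, hs₁⟩ := e₁.exists_size_le
    obtain ⟨s₂, hs₂⟩ := e₂.exists_size_le
    refine ⟨p₁ + p₂ + 2 * s₁ + 2 * s₂ + 10, fun b σ Γ d hd hb h1 h2 => ?_⟩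
    obtain ⟨t, τ, g1, g2, g3, g4, g5⟩ := hp₁ b σ Γ d hd hb h1 h2
    have hag : Agree σ τ := ⟨g3, fun r hr => g4 r (by omega)⟩
    have hmap : Γ.map τ.reg = Γ.map σ.reg := List.map_congr_left fun r hr => g4 r (h1 r hr)
    obtain ⟨t', τ', k1, k2, k3, k4, k5⟩ := hp₂ b τ Γ (d + 1) (by omega) (hb.congr hag)
      (fun r hr => (h1 r hr).trans (by omega)) (fun r hr => by rw [g4 r (h1 r hr)]; exact h2 r hr)
    rw [Term.eval_agree hag, hmap] at k5
    refine ⟨_, _, .seq g1 (.seq k1 (.assign _ _ _)), ?_, k3.trans g3, fun r hr => ?_, ?_⟩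
    · have l1 := hs₁ b σ (Γ.map σ.reg) hb (by simpa using h2)
      have l2 := hs₂ b σ (Γ.map σ.reg) hb (by simpa using h2)
      have l3 := size_eval_le op (e₁.eval σ (Γ.map σ.reg)) (e₂.eval σ (Γ.map σ.reg))
      simp only [Expr.time, Expr.eval, k5, k4 d (by omega), g5, eval_add, eval_mul, eval_ofNat]
      omega
    · simp only [State.setReg]
      rw [Function.update_of_ne hr.ne, k4 r (by omega), g4 r hr]
    · simp [State.setReg, Expr.eval, Term.eval, k5, k4 d (by omega), g5]
  | sum n e ih =>
    obtain ⟨p, hp⟩ := ih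
    obtain ⟨s, hs⟩ := e.exists_size_le
    -- The bound of `yields_foldProgram`, where `X + s` bounds the lengths of the summands and of
    -- all partial sums.
    refine ⟨10 + (X + s) + (X + 1) * (20 + 6 * X + 3 * (X + s) + p),
      fun b σ Γ d hd hb h1 h2 => ?_⟩
    have hf : ∀ j < σ.reg n, Nat.size (e.eval σ (j :: Γ.map σ.reg)) ≤ s.eval b := fun j hj => by
      refine hs b σ _ hb ?_
      have := hb.dim n
      simpa using ⟨(size_le_self j).trans (by omega), h2⟩
    simp only [eval_add, eval_mul, eval_X, eval_ofNat, eval_one]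
    refine yields_foldProgram (op := .add) (f := fun j => e.eval σ (j :: Γ.map σ.reg))
      (acc := fun j => ∑ i ∈ Finset.range j, e.eval σ (i :: Γ.map σ.reg)) (by omega)
      (hb.dim n) rfl (fun j => Finset.sum_range_succ _ _) ?_
      (fun j hj => (hf j hj).trans (by omega)) ?_
    · intro j hj
      exact size_sum_le (hj.trans (hb.dim n)) fun i hi => hf i (by omega)
    · intro j hj τ k1 k2 k3
      have hag : Agree σ τ := ⟨k1, fun r hr => k2 r (by omega)⟩
      have := hp b τ ((d + 1) :: Γ) (d + 2) (by omega) (hb.congr hag)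
        (by simpa using fun r hr => (h1 r hr).trans (by omega))
        (by
          have := hb.dim n
          simpa [k3] using ⟨(size_le_self j).trans (by omega),
            fun r hr => by rw [k2 r (h1 r hr)]; exact h2 r hr⟩)
      rwa [Term.eval_agree hag, List.map_cons, k3,
        List.map_congr_left fun r hr => k2 r (h1 r hr)] at this
  | prod n e ih =>
    obtain ⟨p, hp⟩ := ih
    obtain ⟨s, hs⟩ := e.exists_size_le
    refine ⟨10 + (X * s + 1 + s) + (X + 1) * (20 + 6 * X + 3 * (X * s + 1 + s) + p),
      fun b σ Γ d hd hb h1 h2 => ?_⟩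
    have hf : ∀ j < σ.reg n, Nat.size (e.eval σ (j :: Γ.map σ.reg)) ≤ s.eval b := fun j hj => by
      refine hs b σ _ hb ?_
      have := hb.dim n
      simpa using ⟨(size_le_self j).trans (by omega), h2⟩
    simp only [eval_add, eval_mul, eval_X, eval_ofNat, eval_one]
    refine yields_foldProgram (op := .mul) (f := fun j => e.eval σ (j :: Γ.map σ.reg))
      (acc := fun j => ∏ i ∈ Finset.range j, e.eval σ (i :: Γ.map σ.reg)) (by omega)
      (hb.dim n) rfl (fun j => Finset.prod_range_succ _ _) ?_
      (fun j hj => (hf j hj).trans (by omega)) ?_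
    · intro j hj
      exact (size_prod_le (hj.trans (hb.dim n)) fun i hi => hf i (by omega)).trans (by omega)
    · intro j hj τ k1 k2 k3
      have hag : Agree σ τ := ⟨k1, fun r hr => k2 r (by omega)⟩
      have := hp b τ ((d + 1) :: Γ) (d + 2) (by omega) (hb.congr hag)
        (by simpa using fun r hr => (h1 r hr).trans (by omega))
        (by
          have := hb.dim n
          simpa [k3] using ⟨(size_le_self j).trans (by omega),
            fun r hr => by rw [k2 r (h1 r hr)]; exact h2 r hr⟩)
      rwa [Term.eval_agree hag, List.map_cons, k3,
        List.map_congr_left fun r hr => k2 r (h1 r hr)] at this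

/-! ### Loop-free commands -/

/-- Assignments to variables, assignments to all entries of an array below a dimension (where
bound variable `0` is the index), and composition. -/
inductive Cmd
  | set (y : Fin 14) (e : Term)
  | map (a : ℕ) (n : Fin 2) (e : Term)
  | seq (c₁ c₂ : Cmd)

namespace Cmd

def den : Cmd → State → State
  | set y e, σ => σ.setReg (y + 2) (e.eval σ [])
  | map a n e, σ => ⟨σ.reg, Function.update σ.arr a fun j =>
      if j < σ.reg n then e.eval σ [j] else σ.arr a j⟩
  | seq c₁ c₂, σ => c₂.den (c₁.den σ)

def compile : Cmd → Program
  | set y e => .seq (e.compile [] 16) (.assign (y + 2) (.reg 16))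
  | map a n e => .seq (.assign 16 (.lit 0)) <|
      .loop (.bin .lt (.reg 16) (.reg n)) <| .seq (e.compile [16] 17) <|
        .seq (.put a (.reg 16) (.reg 17)) (.assign 16 (.bin .add (.reg 16) (.lit 1)))
  | seq c₁ c₂ => .seq c₁.compile c₂.compile

/-- No array assignment reads the array that it writes. -/
def WellFormed : Cmd → Prop
  | set _ _ => True
  | map a _ e => e.Avoids a
  | seq c₁ c₂ => c₁.WellFormed ∧ c₂.WellFormed

open Polynomial in
theorem exists_exec_map (a : ℕ) (n : Fin 2) (e : Term) (h : e.Avoids a) :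
    ∃ p : ℕ[X], ∀ (b : ℕ) (σ : State), Bounded b σ → Bounded (p.eval b) ((map a n e).den σ) ∧
      ∀ σ', Agree σ σ' → ∃ t τ, Exec (map a n e).compile σ' t τ ∧ t ≤ p.eval b ∧
        Agree ((map a n e).den σ) τ := by
  obtain ⟨s, hs⟩ := e.exists_size_le
  obtain ⟨p, hp⟩ := e.exists_yields
  refine ⟨X + s + (2 + (X + 1) * (20 + 6 * X + s + p.comp (X + s))), fun b σ hb => ?_⟩
  have hP : (X + s + (2 + (X + 1) * (20 + 6 * X + s + p.comp (X + s)))).eval b =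
      b + s.eval b + (2 + (b + 1) * (20 + 6 * b + s.eval b + p.eval (b + s.eval b))) := by
    simp
  rw [hP]
  -- Bounds every partially updated memory: an entry is either old or a value of the term.
  set B := b + s.eval b with hB
  have hv : ∀ j < σ.reg n, Nat.size (e.eval σ [j]) ≤ s.eval b := fun j hj => by
    have := hb.dim n
    exact hs b σ _ hb (by simpa using (size_le_self j).trans (by omega))
  have hpart : ∀ k ≤ σ.reg n, Bounded B ⟨σ.reg, Function.update σ.arr a fun j =>
      if j < k then e.eval σ [j] else σ.arr a j⟩ := by
    intro k hk
    refine ⟨fun n => (hb.dim n).trans (by omega), fun r hr => (hb.reg r hr).trans (by omega),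
      fun a' j => ?_⟩
    have h1 := hb.arr a' j
    by_cases haa : a' = a
    · subst haa
      simp only [Function.update_self]
      split_ifs with hj
      · exact (hv j (by omega)).trans (by omega)
      · omega
    · simp only [Function.update_of_ne haa]
      omega
  refine ⟨(hpart _ le_rfl).mono (by omega), fun σ' hσ' => ?_⟩
  let I : ℕ → State → Prop := fun k τ => τ.reg 16 = k ∧ (∀ r < 16, τ.reg r = σ.reg r) ∧
    τ.arr = Function.update σ.arr a fun j => if j < k then e.eval σ [j] else σ.arr a j
  have hsize : ∀ j ≤ σ.reg n, Nat.size j ≤ b := fun j hj =>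
    (size_le_self j).trans (hj.trans (hb.dim n))
  have s0 : Nat.size 0 = 0 := by simp
  have s1 : Nat.size 1 = 1 := by simp
  have slt : ∀ x y : ℕ, Nat.size (if x < y then 1 else 0) ≤ 1 := by
    intro x y; split_ifs <;> simp
  have key := exec_loop (e := .bin .lt (.reg 16) (.reg n))
    (c := .seq (e.compile [16] 17) <| .seq (.put a (.reg 16) (.reg 17))
      (.assign 16 (.bin .add (.reg 16) (.lit 1)))) I (σ.reg n) (4 + 2 * b)
    (p.eval B + (3 + b + s.eval b) + (8 + 2 * b)) ?_ ?_ ?_ (σ := σ'.setReg 16 0) ?_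
  · obtain ⟨t, τ, h1, h2, h3, h4, h5⟩ := key
    refine ⟨_, τ, .seq (.assign _ _ _) h1, ?_, h5, h4⟩
    simp only [Expr.time, s0]
    have h7 : (σ.reg n + 1) * (1 + (4 + 2 * b) + (p.eval B + (3 + b + s.eval b) + (8 + 2 * b)))
        ≤ (b + 1) * (20 + 6 * b + s.eval b + p.eval B) :=
      Nat.mul_le_mul (by have := hb.dim n; omega) (by omega)
    omega
  · rintro j hj τ ⟨h1, h2, h3⟩
    simp only [Expr.time, Expr.eval, BinOp.eval, h1, h2 n (by omega)]
    have := hsize j hj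
    have := hsize _ le_rfl
    have := slt j (σ.reg n)
    omega
  · rintro j hj τ ⟨h1, h2, h3⟩
    refine ⟨by simp [Expr.eval, BinOp.eval, h1, h2 n (by omega), hj], ?_⟩
    have hτ : Bounded B τ := (hpart j hj.le).congr ⟨h3, fun r hr => h2 r hr⟩
    obtain ⟨t, υ, g1, g2, g3, g4, g5⟩ := hp B τ [16] 17 (by omega) hτ (by simp)
      (by simpa [h1] using (hsize j hj.le).trans (by omega))
    -- The array is partly overwritten in `τ`, but the term does not read it.
    have hev : e.eval τ [j] = e.eval σ [j] :=
      Term.eval_congr h2 (fun a' ha' => by rw [h3, Function.update_of_ne ha']) h [j]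
    simp only [List.map_cons, List.map_nil, h1, hev] at g5
    have e1 : υ.reg 16 = j := by rw [g4 16 (by omega), h1]
    refine ⟨_, _, .seq g1 (.seq (.put _ _ _ _) (.assign _ _ _)), ?_, ?_, ?_, ?_⟩
    · simp only [Expr.time, Expr.eval, BinOp.eval, State.setArr, e1, g5, s1]
      have := hv j hj
      have := hsize j hj.le
      have := hsize (j + 1) hj
      omega
    · simp [State.setReg, State.setArr, Expr.eval, BinOp.eval, e1]
    · intro r hr
      simp only [State.setReg, State.setArr]
      rw [Function.update_of_ne (by omega), g4 r (by omega), h2 r hr]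
    · simp only [State.setReg, State.setArr, Expr.eval, e1, g5, g3, h3, Function.update_self,
        Function.update_idem]
      congr 1
      funext i
      by_cases hi : i = j
      · subst hi; simp
      · rw [Function.update_of_ne hi]
        have : i < j ↔ i < j + 1 := by omega
        simp only [this]
  · rintro τ ⟨h1, h2, h3⟩
    simp [Expr.eval, BinOp.eval, h1, h2 n (by omega)]
  · refine ⟨by simp [State.setReg], fun r hr => ?_, ?_⟩
    · simp only [State.setReg]
      rw [Function.update_of_ne (by omega), hσ'.2 r hr]
    · simp [State.setReg, hσ'.1]

open Polynomial in
-- Sequencing composes the polynomials, which is harmless for a fixed command. Starting from any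
-- agreeing state allows for whatever earlier commands left in the scratch registers.
theorem exists_exec (c : Cmd) (hc : c.WellFormed) : ∃ p : ℕ[X], ∀ (b : ℕ) (σ : State),
    Bounded b σ → Bounded (p.eval b) (c.den σ) ∧ ∀ σ', Agree σ σ' →
      ∃ t τ, Exec c.compile σ' t τ ∧ t ≤ p.eval b ∧ Agree (c.den σ) τ := by
  induction c with
  | set y e =>
    obtain ⟨s, hs⟩ := e.exists_size_le
    obtain ⟨p, hp⟩ := e.exists_yields
    refine ⟨X + s + p + 2, fun b σ hb => ?_⟩
    have h1 := hs b σ [] hb (by simp)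
    have hP : (X + s + p + 2).eval b = b + s.eval b + p.eval b + 2 := by simp
    rw [hP]
    refine ⟨⟨fun n => ?_, fun r hr => ?_, fun a j => ?_⟩, fun σ' hσ' => ?_⟩
    · have := hb.dim n
      simp only [den, State.setReg]
      rw [Function.update_of_ne (by omega)]
      omega
    · have := hb.reg r hr
      simp only [den, State.setReg, Function.update_apply]
      split_ifs <;> omega
    · have := hb.arr a j
      simp only [den, State.setReg]
      omega
    · obtain ⟨t, τ, g1, g2, g3, g4, g5⟩ := hp b σ' [] 16 le_rfl (hb.congr hσ') (by simp) (by simp)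
      rw [Term.eval_agree hσ', List.map_nil] at g5
      refine ⟨_, _, .seq g1 (.assign _ _ _), ?_, ?_, fun r hr => ?_⟩
      · simp only [Expr.time, g5]
        omega
      · simp [den, State.setReg, g3, hσ'.1]
      · simp only [den, State.setReg, Expr.eval, g5, Function.update_apply, g4 r hr, hσ'.2 r hr]
  | map a n e => exact exists_exec_map a n e hc
  | seq c₁ c₂ ih₁ ih₂ =>
    obtain ⟨p₁, h₁⟩ := ih₁ hc.1
    obtain ⟨p₂, h₂⟩ := ih₂ hc.2
    refine ⟨p₁ + p₂.comp p₁, fun b σ hb => ?_⟩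
    have hP : (p₁ + p₂.comp p₁).eval b = p₁.eval b + p₂.eval (p₁.eval b) := by simp
    rw [hP]
    obtain ⟨k₁, l₁⟩ := h₁ b σ hb
    obtain ⟨k₂, l₂⟩ := h₂ _ _ k₁
    refine ⟨k₂.mono (by omega), fun σ' hσ' => ?_⟩
    obtain ⟨t, τ, g1, g2, g3⟩ := l₁ σ' hσ'
    obtain ⟨t', τ', g1', g2', g3'⟩ := l₂ τ g3
    exact ⟨_, τ', .seq g1 g1', by omega, g3'⟩

/-- Run `pre`, then `body` as long as variable `y` is less than the dimension `0`, then `post`. -/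
def whileProgram (pre body post : Cmd) (y : Fin 14) : Program :=
  .seq pre.compile (.seq (.loop (.bin .lt (.reg (y + 2)) (.reg 0)) body.compile) post.compile)

open Polynomial in
-- Composing the growth bound of `body` with itself in every round would not give a polynomial.
-- Therefore one bound `B` for all intermediate states is a hypothesis, to be supplied by the
-- analysis of the method.
theorem exists_exec_while {α : Type} (size : α → ℕ) (input : α → State) {pre body post : Cmd}
    (h₁ : pre.WellFormed) (h₂ : body.WellFormed) (h₃ : post.WellFormed) (y : Fin 14)
    (B T : ℕ[X]) (n : α → ℕ) (hn : ∀ x, n x ≤ T.eval (size x))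
    (hin : ∀ x, Bounded (B.eval (size x)) (input x))
    (hb : ∀ x, ∀ j ≤ n x, Bounded (B.eval (size x)) (body.den^[j] (pre.den (input x))))
    (hlt : ∀ x, ∀ j < n x, (body.den^[j] (pre.den (input x))).reg (y + 2) <
      (body.den^[j] (pre.den (input x))).reg 0)
    (hend : ∀ x, (body.den^[n x] (pre.den (input x))).reg 0 ≤
      (body.den^[n x] (pre.den (input x))).reg (y + 2)) :
    ∃ p : ℕ[X], ∀ x, ∃ t τ, Exec (whileProgram pre body post y) (input x) t τ ∧
      t ≤ p.eval (size x) ∧ Agree (post.den (body.den^[n x] (pre.den (input x)))) τ := by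
  obtain ⟨p₁, k₁⟩ := exists_exec pre h₁
  obtain ⟨p₂, k₂⟩ := exists_exec body h₂
  obtain ⟨p₃, k₃⟩ := exists_exec post h₃
  refine ⟨p₁.comp B + (T + 1) * (1 + (4 + 2 * B) + p₂.comp B) + p₃.comp B, fun x => ?_⟩
  simp only [eval_add, eval_mul, eval_comp, eval_one, eval_ofNat]
  set b := B.eval (size x)
  set σ : ℕ → State := fun j => body.den^[j] (pre.den (input x)) with hσ
  obtain ⟨t₁, τ₁, e₁, l₁, a₁⟩ := (k₁ b _ (hin x)).2 _ (Agree.refl _)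
  have slt : ∀ x y : ℕ, Nat.size (if x < y then 1 else 0) ≤ 1 := by
    intro x y; split_ifs <;> simp
  obtain ⟨t₂, τ₂, e₂, l₂, a₂⟩ := exec_loop (e := .bin .lt (.reg (y + 2)) (.reg 0))
    (c := body.compile) (fun j τ => Agree (σ j) τ) (n x) (4 + 2 * b) (p₂.eval b)
    (fun j hj τ hτ => by
      have h1 := (hb x j hj).reg (y + 2) (by omega)
      have h2 := (hb x j hj).reg 0 (by omega)
      simp only [Expr.time, Expr.eval, BinOp.eval, hτ.2 (y + 2) (by omega), hτ.2 0 (by omega), hσ]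
      have := slt ((body.den^[j] (pre.den (input x))).reg (y + 2))
        ((body.den^[j] (pre.den (input x))).reg 0)
      omega)
    (fun j hj τ hτ => by
      refine ⟨?_, ?_⟩
      · simp [Expr.eval, BinOp.eval, hτ.2 (y + 2) (by omega), hτ.2 0 (by omega), hσ, hlt x j hj]
      · obtain ⟨t, υ, e, l, a⟩ := (k₂ b _ (hb x j hj.le)).2 τ hτ
        refine ⟨t, υ, e, l, ?_⟩
        simpa only [hσ, Function.iterate_succ_apply'] using a)
    (fun τ hτ => by
      simp [Expr.eval, BinOp.eval, hτ.2 (y + 2) (by omega), hτ.2 0 (by omega), hσ, hend x])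
    (σ := τ₁) a₁
  obtain ⟨t₃, τ₃, e₃, l₃, a₃⟩ := (k₃ b _ (hb x (n x) le_rfl)).2 τ₂ a₂
  refine ⟨_, τ₃, .seq e₁ (.seq e₂ e₃), ?_, a₃⟩
  have : (n x + 1) * (1 + (4 + 2 * b) + p₂.eval b) ≤
      (T.eval (size x) + 1) * (1 + (4 + 2 * b) + p₂.eval b) :=
    Nat.mul_le_mul_right _ (by have := hn x; omega)
  omega

end Cmd

end SetCover

namespace SetCover

/-! ### First index with a property -/

/-- The first index `i < n` with `b i ≠ 0`, and `n` if there is none. -/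
def firstIdx (n : ℕ) (b : ℕ → ℕ) : ℕ :=
  ∑ j ∈ Finset.range n, ∏ i ∈ Finset.range n, (1 - (1 - if j < i then 1 else 0) * b i)

/-- By truncated subtraction, summand `j` is 1 if `b` vanishes at all indices up to `j`, and 0
otherwise, so the sum counts the indices before the first hit. Sums and products are used because a
`Term` can express them. -/
theorem firstIdx_eq {n f : ℕ} {b : ℕ → ℕ} (hf : f ≤ n) (h : ∀ j < f, b j = 0)
    (hb : f < n → b f ≠ 0) : firstIdx n b = f := by
  have : ∀ j ∈ Finset.range n,
      ∏ i ∈ Finset.range n, (1 - (1 - if j < i then 1 else 0) * b i) =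
        if j < f then 1 else 0 := by
    intro j hj
    rw [Finset.mem_range] at hj
    split_ifs with hjf
    · refine Finset.prod_eq_one fun i _ => ?_
      split_ifs with hji
      · simp
      · simp [h i (by omega)]
    · have hfn : f < n := by omega
      refine Finset.prod_eq_zero (Finset.mem_range.2 hfn) ?_
      rw [if_neg (by omega)]
      have := hb hfn
      omega
  rw [firstIdx, Finset.sum_congr rfl this, ← Finset.sum_filter]
  have hs : (Finset.range n).filter (· < f) = Finset.range f := by
    ext j; simp; omega
  simp [hs]

theorem firstIdx_le (n : ℕ) (b : ℕ → ℕ) : firstIdx n b ≤ n := by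
  by_cases h : ∃ i, i < n ∧ b i ≠ 0
  · classical
    have hs := Nat.find_spec h
    rw [firstIdx_eq (f := Nat.find h) hs.1.le (fun j hj => ?_) fun _ => hs.2]
    · exact hs.1.le
    · by_contra hne
      exact Nat.find_min h hj ⟨hj.trans hs.1, hne⟩
  · push Not at h
    exact (firstIdx_eq le_rfl h fun h => absurd h (lt_irrefl _)).le

theorem firstIdx_spec {n : ℕ} {b : ℕ → ℕ} (h : ∃ i < n, b i ≠ 0) :
    firstIdx n b < n ∧ b (firstIdx n b) ≠ 0 ∧ ∀ j < firstIdx n b, b j = 0 := by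
  classical
  have hs := Nat.find_spec h
  have hm : ∀ j < Nat.find h, b j = 0 := fun j hj => by
    by_contra hne
    exact Nat.find_min h hj ⟨hj.trans hs.1, hne⟩
  rw [firstIdx_eq hs.1.le hm fun _ => hs.2]
  exact ⟨hs.1, hs.2, hm⟩

theorem firstIdx_lt_iff {n : ℕ} {b : ℕ → ℕ} : firstIdx n b < n ↔ ∃ i < n, b i ≠ 0 := by
  refine ⟨fun h => ?_, fun h => (firstIdx_spec h).1⟩
  by_contra hne
  push Not at hne
  exact h.ne (firstIdx_eq le_rfl hne fun h => absurd h (lt_irrefl _))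

/-! ### Learning a fractional cover from a sample -/

/-- A covering problem with integer costs: `m` sets, `N` elements, the incidence matrix `a`, the
costs `c`, and the parameters `k` (sample size) and `L` (a bound for logarithms). -/
structure Problem where
  m : ℕ
  N : ℕ
  k : ℕ
  L : ℕ
  a : ℕ → ℕ → ℕ
  c : ℕ → ℕ

/-- The state of the multiplicative weights method: a guess `β` of the optimum, the total cost `M`
of the mistakes made with this guess, and the weights of the sets. -/
structure Learner where
  β : ℕ
  M : ℕ
  w : ℕ → ℕ

namespace Problem

variable (P : Problem)

/-- The matrix `a` has entries `0` and `1`, and every element is covered. -/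
structure Valid : Prop where
  le_one : ∀ i u, P.a i u ≤ 1
  covered : ∀ u < P.N, ∃ i < P.m, P.a i u ≠ 0

/-- The first of the cheapest sets that contain `u`. -/
def cheapest (u : ℕ) : ℕ :=
  firstIdx P.m fun i => P.a i u *
    (1 - ∑ i' ∈ Finset.range P.m, P.a i' u * if P.c i' < P.c i then 1 else 0)

/-- The cost of a cheapest set that contains `u`. -/
def κ (u : ℕ) : ℕ := P.c (P.cheapest u)

def total (s : Learner) : ℕ := ∑ i ∈ Finset.range P.m, s.w i

/-- The extent to which `u` is covered, multiplied by the total weight. -/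
def load (s : Learner) (u : ℕ) : ℕ :=
  ∑ i ∈ Finset.range P.m, P.a i u * (s.β * s.w i / P.c i)

/-- `1` if `u` is expensive and poorly covered, and `0` otherwise. -/
def bad (s : Learner) (u : ℕ) : ℕ :=
  (if s.β < P.κ u * P.k then 1 else 0) * (1 - if P.total s < 8 * P.load s u then 1 else 0)

/-- The first bad element of the sample `R`, and `N` if there is none. -/
def select (R : Finset ℕ) (s : Learner) : ℕ :=
  firstIdx P.N fun u => (if u ∈ R then 1 else 0) * P.bad s u

def update (s : Learner) (u : ℕ) : Learner :=
  if s.β < P.κ u ∨ 8 * s.β * P.L < s.M then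
    ⟨2 * (s.β + (P.κ u - s.β)), 0, fun i => if 2 * (s.β + (P.κ u - s.β)) < P.c i then 0 else P.k⟩
  else ⟨s.β, s.M + P.κ u, fun i => s.w i + P.a i u * (s.w i * P.κ u / P.c i)⟩

def step (R : Finset ℕ) (s : Learner) : Learner :=
  if P.select R s < P.N then P.update s (P.select R s) else s

def run (R : Finset ℕ) (n : ℕ) : Learner := (P.step R)^[n] ⟨0, 0, fun _ => 0⟩

/-- The cost of a collection of sets. -/
def price (T : Finset ℕ) : ℕ := ∑ i ∈ T, P.c i

/-- `T` is a collection of sets that covers `R`. -/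
structure Covers (T R : Finset ℕ) : Prop where
  subset : T ⊆ Finset.range P.m
  exists_mem : ∀ u ∈ R, ∃ i ∈ T, P.a i u ≠ 0

/-- A number of steps after which no bad element is left in the sample. -/
def fuel : ℕ :=
  (P.k * (8 * P.L + 1) + 1) * (1 + Nat.size (2 * P.price (Finset.range P.m)))

def final (R : Finset ℕ) : Learner := P.run R P.fuel

variable {P}

theorem Covers.mono {T R R' : Finset ℕ} (h : P.Covers T R') (hR : R ⊆ R') : P.Covers T R :=
  ⟨h.1, fun u hu => h.2 u (hR hu)⟩

theorem Valid.cheapest_spec (hP : P.Valid) {u : ℕ} (hu : u < P.N) :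
    P.cheapest u < P.m ∧ P.a (P.cheapest u) u ≠ 0 ∧
      ∀ i < P.m, P.a i u ≠ 0 → P.κ u ≤ P.c i := by
  have hex : ∃ i < P.m, P.a i u *
      (1 - ∑ i' ∈ Finset.range P.m, P.a i' u * if P.c i' < P.c i then 1 else 0) ≠ 0 := by
    obtain ⟨i₀, h₀, h₁⟩ := hP.covered u hu
    obtain ⟨i, hi, hmin⟩ := Finset.exists_min_image
      ((Finset.range P.m).filter fun i => P.a i u ≠ 0) P.c ⟨i₀, by simp [h₀, h₁]⟩
    simp only [Finset.mem_filter, Finset.mem_range] at hi hmin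
    refine ⟨i, hi.1, ?_⟩
    have : ∑ i' ∈ Finset.range P.m, P.a i' u * (if P.c i' < P.c i then 1 else 0) = 0 := by
      refine Finset.sum_eq_zero fun i' hi' => ?_
      by_cases ha : P.a i' u = 0
      · simp [ha]
      · rw [if_neg (not_lt.2 (hmin i' ⟨Finset.mem_range.1 hi', ha⟩)), mul_zero]
    rw [this]
    simpa using hi.2
  obtain ⟨h1, h2, -⟩ := firstIdx_spec hex
  have h1' : P.cheapest u < P.m := h1
  change P.a (P.cheapest u) u *
    (1 - ∑ i' ∈ Finset.range P.m, P.a i' u * if P.c i' < P.c (P.cheapest u) then 1 else 0) ≠ 0 at h2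
  refine ⟨h1', left_ne_zero_of_mul h2, fun i hi ha => ?_⟩
  by_contra hlt
  rw [not_le] at hlt
  have h3 := right_ne_zero_of_mul h2
  have h4 := Finset.single_le_sum (s := Finset.range P.m)
    (f := fun i' => P.a i' u * if P.c i' < P.c (P.cheapest u) then 1 else 0)
    (fun _ _ => Nat.zero_le _) (Finset.mem_range.2 hi)
  simp only [if_pos (show P.c i < P.c (P.cheapest u) from hlt)] at h4
  omega

theorem bad_ne_zero {s : Learner} {u : ℕ} :
    P.bad s u ≠ 0 ↔ s.β < P.κ u * P.k ∧ 8 * P.load s u ≤ P.total s := by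
  unfold bad
  split_ifs <;> simp <;> omega

theorem select_le (R : Finset ℕ) (s : Learner) : P.select R s ≤ P.N := firstIdx_le _ _

theorem select_spec {R : Finset ℕ} {s : Learner} (h : P.select R s < P.N) :
    P.select R s ∈ R ∧ P.bad s (P.select R s) ≠ 0 := by
  obtain ⟨-, h2, -⟩ := firstIdx_spec (firstIdx_lt_iff.1 h)
  change (if P.select R s ∈ R then 1 else 0) * P.bad s (P.select R s) ≠ 0 at h2
  refine ⟨?_, right_ne_zero_of_mul h2⟩
  by_contra hR
  simp [hR] at h2

theorem bad_eq_zero_of_select {R : Finset ℕ} {s : Learner} (h : P.N ≤ P.select R s) {u : ℕ}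
    (hu : u < P.N) (hR : u ∈ R) : P.bad s u = 0 := by
  by_contra hb
  exact absurd (firstIdx_lt_iff.2 ⟨u, hu, by simp [hR, hb]⟩) (not_lt.2 h)

/-- The basis of the leave-one-out argument: the sample influences a step only through its first bad
element. -/
theorem select_erase {R : Finset ℕ} {v : ℕ} {s : Learner} (hv : P.select R s ≠ v) :
    P.select (R.erase v) s = P.select R s := by
  by_cases h : P.select R s < P.N
  · obtain ⟨h1, h2, h3⟩ := firstIdx_spec (firstIdx_lt_iff.1 h)
    have h4 := select_spec h
    refine firstIdx_eq h.le (fun j hj => ?_) fun _ => ?_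
    · have := h3 j hj
      by_cases hj : j ∈ R
      · have hb : P.bad s j = 0 := by simpa [hj] using this
        simp [hb]
      · simp [hj]
    · simp [h4.1, h4.2, hv]
  · rw [not_lt] at h
    have hN := le_antisymm (select_le R s) h
    rw [hN]
    refine firstIdx_eq le_rfl (fun j hj => ?_) fun h => absurd h (lt_irrefl _)
    by_cases hjR : j ∈ R
    · simp [bad_eq_zero_of_select h hj hjR]
    · simp [hjR]

/-! ### The potential argument -/

/-- What holds in all states of the method, if `T` covers the sample. -/
structure Inv (P : Problem) (T : Finset ℕ) (s : Learner) : Prop where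
  guess : s.β ≤ 2 * P.price T
  mistakes : s.M ≤ 8 * s.β * P.L + s.β
  light : 0 < s.β → ∀ i < P.m, P.c i ≤ s.β → P.k ≤ s.w i
  heavy : 0 < s.β → ∀ i < P.m, s.β < P.c i → s.w i = 0
  total : 0 < s.β → (P.total s : ℝ) ≤ P.m * P.k * Real.exp (s.M / (4 * s.β))
  gain : 0 < s.β → P.price T ≤ s.β →
    2 / 5 * (s.M : ℝ) ≤ ∑ i ∈ T, P.c i * Real.log (s.w i / P.k)

/-- No weight exceeds the total, so each logarithm in `gain` is at most `log m + M / (4 * β)`, while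
the costs in `T` sum to at most `β`. Thus a guess that is large enough never exhausts its allowance
for mistakes. -/
theorem Inv.mistakes_le {T : Finset ℕ} {s : Learner} (h : P.Inv T s) (hT : T ⊆ Finset.range P.m)
    (hL : Real.log P.m ≤ P.L) (hk : 0 < P.k) (hβ : 0 < s.β) (hp : P.price T ≤ s.β) :
    s.M ≤ 8 * s.β * P.L := by
  have hβ' : (0 : ℝ) < s.β := by exact_mod_cast hβ
  have hk' : (0 : ℝ) < P.k := by exact_mod_cast hk
  have h1 : ∀ i ∈ T, (P.c i : ℝ) * Real.log (s.w i / P.k) ≤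
      P.c i * (Real.log P.m + s.M / (4 * s.β)) := by
    intro i hi
    have him := Finset.mem_range.1 (hT hi)
    have hm : (0 : ℝ) < P.m := by exact_mod_cast (by omega : 0 < P.m)
    have hci : P.c i ≤ s.β :=
      (Finset.single_le_sum (f := P.c) (fun _ _ => Nat.zero_le _) hi).trans hp
    have hw : P.k ≤ s.w i := h.light hβ i him hci
    have hw' : s.w i ≤ P.total s :=
      Finset.single_le_sum (f := s.w) (fun _ _ => Nat.zero_le _) (hT hi)
    have hw0 : (0 : ℝ) < s.w i := by exact_mod_cast (by omega : 0 < s.w i)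
    refine mul_le_mul_of_nonneg_left ?_ (Nat.cast_nonneg _)
    have : (s.w i : ℝ) / P.k ≤ P.m * Real.exp (s.M / (4 * s.β)) := by
      rw [div_le_iff₀ hk']
      calc (s.w i : ℝ) ≤ P.total s := by exact_mod_cast hw'
        _ ≤ _ := h.total hβ
        _ = _ := by ring
    calc Real.log (s.w i / P.k) ≤ Real.log (P.m * Real.exp (s.M / (4 * s.β))) :=
          Real.log_le_log (by positivity) this
      _ = _ := by rw [Real.log_mul hm.ne' (Real.exp_pos _).ne', Real.log_exp]
  have h2 := (h.gain hβ hp).trans (Finset.sum_le_sum h1)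
  rw [← Finset.sum_mul] at h2
  have h3 : (∑ i ∈ T, (P.c i : ℝ)) ≤ s.β := by exact_mod_cast hp
  have h4 : (0 : ℝ) ≤ Real.log P.m + s.M / (4 * s.β) :=
    add_nonneg (Real.log_natCast_nonneg _) (by positivity)
  have h5 := h2.trans (mul_le_mul_of_nonneg_right h3 h4)
  have h6 : (s.β : ℝ) * (Real.log P.m + s.M / (4 * s.β)) = s.β * Real.log P.m + s.M / 4 := by
    field_simp
  have h7 := mul_le_mul_of_nonneg_left hL hβ'.le
  have h9 : (0 : ℝ) ≤ s.β * P.L := by positivity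
  -- From `2/5 * M ≤ β * L + M/4`, that is, `M ≤ 20/3 * β * L`.
  have h8 : (s.M : ℝ) ≤ 8 * s.β * P.L := by
    rw [h6] at h5
    linarith
  exact_mod_cast h8

/-- Rounding down a quotient that is at least 1 loses at most a factor 2. Starting the light weights
at `k` and the heavy ones at 0 keeps the relevant quotients in this range. -/
theorem natDiv_half {x c : ℕ} (hc : 0 < c) (h : c ≤ x ∨ x = 0) :
    (x : ℝ) / c ≤ 2 * ((x / c : ℕ) : ℝ) := by
  rcases h with h | rfl
  · have h1 : 1 ≤ x / c := (Nat.one_le_div_iff hc).2 h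
    have h2 : x < (x / c + 1) * c := by
      have := Nat.lt_div_mul_add (a := x) hc
      rw [add_one_mul]; exact this
    have hc' : (0 : ℝ) < c := by exact_mod_cast hc
    rw [div_le_iff₀ hc']
    have h3 : x ≤ 2 * (x / c) * c := by nlinarith
    exact_mod_cast h3
  · simp

/-- Without floors the increase is `κ u / β` times the load. The floor in the load costs a factor 2,
and a poorly covered element has load at most `total / 8`, which gives `κ u / (4 * β)`. -/
theorem total_update_le {s : Learner} {u : ℕ} (hP : P.Valid) (hu : u < P.N)
    (hβ : 0 < s.β) (hκ : 0 < P.κ u) (hload : 8 * P.load s u ≤ P.total s)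
    (hheavy : ∀ i < P.m, s.β < P.c i → s.w i = 0) :
    ((∑ i ∈ Finset.range P.m, (s.w i + P.a i u * (s.w i * P.κ u / P.c i)) : ℕ) : ℝ) ≤
      P.total s * (1 + P.κ u / (4 * s.β)) := by
  have hβ' : (0 : ℝ) < s.β := by exact_mod_cast hβ
  have hterm : ∀ i ∈ Finset.range P.m,
      s.β * ((P.a i u * (s.w i * P.κ u / P.c i) : ℕ) : ℝ) ≤
        2 * P.κ u * ((P.a i u * (s.β * s.w i / P.c i) : ℕ) : ℝ) := by
    intro i hi
    have him := Finset.mem_range.1 hi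
    by_cases ha : P.a i u = 0
    · simp [ha]
    · have hc := (hP.cheapest_spec hu).2.2 i him ha
      have hc0 : 0 < P.c i := by omega
      have hc0' : (0 : ℝ) < P.c i := by exact_mod_cast hc0
      have h1 : ((s.w i * P.κ u / P.c i : ℕ) : ℝ) ≤ s.w i * P.κ u / P.c i := by
        have := Nat.cast_div_le (α := ℝ) (m := s.w i * P.κ u) (n := P.c i)
        simpa using this
      have h2 : ((s.β * s.w i : ℕ) : ℝ) / P.c i ≤ 2 * ((s.β * s.w i / P.c i : ℕ) : ℝ) := by
        refine natDiv_half hc0 ?_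
        by_cases hcb : s.β < P.c i
        · exact Or.inr (by simp [hheavy i him hcb])
        · rcases Nat.eq_zero_or_pos (s.w i) with hw | hw
          · exact Or.inr (by simp [hw])
          · exact Or.inl (by nlinarith)
      push_cast at h2 ⊢
      have ha' : (0 : ℝ) ≤ P.a i u := Nat.cast_nonneg _
      have hk0 : (0 : ℝ) ≤ P.κ u := Nat.cast_nonneg _
      calc (s.β : ℝ) * (P.a i u * ((s.w i * P.κ u / P.c i : ℕ) : ℝ))
          ≤ s.β * (P.a i u * (s.w i * P.κ u / P.c i)) := by gcongr
        _ = P.a i u * P.κ u * (s.β * s.w i / P.c i) := by ring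
        _ ≤ P.a i u * P.κ u * (2 * ((s.β * s.w i / P.c i : ℕ) : ℝ)) := by gcongr
        _ = _ := by ring
  have hsum := Finset.sum_le_sum hterm
  rw [← Finset.mul_sum, ← Finset.mul_sum, ← Nat.cast_sum, ← Nat.cast_sum] at hsum
  change _ ≤ 2 * (P.κ u : ℝ) * (P.load s u : ℝ) at hsum
  have hload' : 8 * (P.load s u : ℝ) ≤ P.total s := by exact_mod_cast hload
  rw [Finset.sum_add_distrib, Nat.cast_add]
  change (P.total s : ℝ) + _ ≤ _
  rw [mul_add, mul_one, ← mul_div_assoc]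
  gcongr
  rw [le_div_iff₀ (by positivity)]
  have hk0 : (0 : ℝ) ≤ P.κ u := Nat.cast_nonneg _
  nlinarith

/-- Since `w * κ ≥ k * κ ≥ c`, the rounded increment is at least half the exact one, so the weight
grows at least by the factor `1 + κ / (2 * c)`. -/
theorem gain_step {w k κ c : ℕ} (hk : 0 < k) (hw : k ≤ w) (hκ : 0 < κ) (hκc : κ ≤ c)
    (hc : c ≤ k * κ) :
    (c : ℝ) * Real.log (w / k) + 2 / 5 * κ ≤ c * Real.log ((w + w * κ / c : ℕ) / k) := by
  have hk' : (0 : ℝ) < k := by exact_mod_cast hk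
  have hw' : (0 : ℝ) < w := by exact_mod_cast hk.trans_le hw
  have hc0 : 0 < c := by omega
  have hc' : (0 : ℝ) < c := by exact_mod_cast hc0
  have hκ' : (0 : ℝ) < κ := by exact_mod_cast hκ
  have hκc' : (κ : ℝ) ≤ c := by exact_mod_cast hκc
  have h1 : ((w * κ : ℕ) : ℝ) / c ≤ 2 * ((w * κ / c : ℕ) : ℝ) :=
    natDiv_half hc0 (Or.inl (hc.trans (Nat.mul_le_mul_right _ hw)))
  have h2 : (w : ℝ) / k * (1 + κ / (2 * c)) ≤ ((w + w * κ / c : ℕ) : ℝ) / k := by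
    rw [div_mul_eq_mul_div]
    gcongr
    push_cast at h1 ⊢
    have : (w : ℝ) * (1 + κ / (2 * c)) = w + w * κ / c / 2 := by field_simp
    rw [this]
    linarith
  -- `log (1 + x) ≥ 2x / (x + 2)` at `x = κ / (2c) ≤ 1/2`; multiplied by `c` this is `κ / (x + 2) ≥
  -- 2/5 * κ`.
  have h3 : 2 * ((κ : ℝ) / (2 * c)) / (κ / (2 * c) + 2) ≤ Real.log (1 + κ / (2 * c)) :=
    Real.le_log_one_add_of_nonneg (by positivity)
  have h4 : 2 / 5 * (κ : ℝ) ≤ c * Real.log (1 + κ / (2 * c)) := by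
    refine le_trans ?_ (mul_le_mul_of_nonneg_left h3 hc'.le)
    have : (c : ℝ) * (2 * ((κ : ℝ) / (2 * c)) / (κ / (2 * c) + 2)) = κ / (κ / (2 * c) + 2) := by
      field_simp
    rw [this, le_div_iff₀ (by positivity)]
    have h5 : (κ : ℝ) / (2 * c) ≤ 1 / 2 := by
      rw [div_le_iff₀ (by positivity)]; linarith
    nlinarith
  calc (c : ℝ) * Real.log (w / k) + 2 / 5 * κ
      ≤ c * Real.log (w / k) + c * Real.log (1 + κ / (2 * c)) := by linarith
    _ = c * Real.log (w / k * (1 + κ / (2 * c))) := by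
      rw [Real.log_mul (by positivity) (by positivity)]; ring
    _ ≤ _ := mul_le_mul_of_nonneg_left (Real.log_le_log (by positivity) h2) hc'.le

/-- At a restart the new guess is twice the maximum of `β` and `κ u`. Here `κ u` is at most the
price of `T` because `T` covers `u`. If the restart is due to the cost of mistakes and `β > 0`, then
`β` is below this price by `mistakes_le`. Without a restart, one set `i₀` of `T` that contains `u`
provides the gain, and the other weights do not decrease. -/
theorem Inv.update {T R : Finset ℕ} {s : Learner} {u : ℕ} (h : P.Inv T s) (hP : P.Valid)
    (hT : P.Covers T R) (hL : Real.log P.m ≤ P.L) (hu : u < P.N) (huR : u ∈ R)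
    (hbad : P.bad s u ≠ 0) : P.Inv T (P.update s u) := by
  obtain ⟨hb1, hb2⟩ := bad_ne_zero.1 hbad
  have hk : 0 < P.k := Nat.pos_of_ne_zero fun h => by simp [h] at hb1
  have hκ : 0 < P.κ u := Nat.pos_of_ne_zero fun h => by simp [h] at hb1
  obtain ⟨i₀, hi₀, ha₀⟩ := hT.exists_mem u huR
  have hmin := (hP.cheapest_spec hu).2.2
  have hκ₀ := hmin i₀ (Finset.mem_range.1 (hT.subset hi₀)) ha₀
  have hκT : P.κ u ≤ P.price T :=
    hκ₀.trans (Finset.single_le_sum (f := P.c) (fun _ _ => Nat.zero_le _) hi₀)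
  have hk' : (0 : ℝ) < P.k := by exact_mod_cast hk
  have hle : ∀ i ∈ T, P.c i ≤ P.price T := fun i hi =>
    Finset.single_le_sum (f := P.c) (fun _ _ => Nat.zero_le _) hi
  unfold Problem.update
  split_ifs with hr
  · refine ⟨?_, by simp, fun _ i _ hi => ?_, fun _ i _ hi => if_pos hi, fun _ => ?_,
      fun _ hp => ?_⟩
    · dsimp only
      rcases hr with hr | hr
      · omega
      · rcases Nat.eq_zero_or_pos s.β with h0 | h0
        · omega
        · have : s.β < P.price T := by
            by_contra hp
            exact absurd hr (not_lt.2 (h.mistakes_le hT.subset hL hk h0 (not_lt.1 hp)))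
          omega
    · dsimp only at hi ⊢
      rw [if_neg (not_lt.2 hi)]
    · have : P.total ⟨2 * (s.β + (P.κ u - s.β)), 0, fun i =>
          if 2 * (s.β + (P.κ u - s.β)) < P.c i then 0 else P.k⟩ ≤ P.m * P.k := by
        refine (Finset.sum_le_card_nsmul (Finset.range P.m) _ P.k fun i _ => ?_).trans (by simp)
        dsimp only
        split_ifs <;> simp
      simpa using (Nat.cast_le (α := ℝ)).2 this
    · dsimp only at hp ⊢
      rw [Finset.sum_eq_zero]
      · simp
      · intro i hi
        have := hle i hi
        rw [if_neg (by omega), div_self hk'.ne', Real.log_one, mul_zero]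
  · push Not at hr
    have hβ : 0 < s.β := by omega
    have hβ' : (0 : ℝ) < s.β := by exact_mod_cast hβ
    have hbound := total_update_le hP hu hβ hκ hb2 (h.heavy hβ)
    refine ⟨h.guess, by dsimp only; omega, fun _ i hi hc => ?_, fun _ i hi hc => ?_, fun _ => ?_,
      fun _ hp => ?_⟩
    · exact (h.light hβ i hi hc).trans (Nat.le_add_right _ _)
    · simp [h.heavy hβ i hi hc]
    · refine hbound.trans ?_
      have h1 := h.total hβ
      have h2 : 1 + (P.κ u : ℝ) / (4 * s.β) ≤ Real.exp (P.κ u / (4 * s.β)) := by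
        rw [add_comm]; exact Real.add_one_le_exp _
      dsimp only
      rw [Nat.cast_add, add_div, Real.exp_add, ← mul_assoc]
      exact mul_le_mul h1 h2 (by positivity) (by positivity)
    · dsimp only at hp ⊢
      have h1 := h.gain hβ hp
      have h2 : ∑ i ∈ T, ((P.c i : ℝ) * Real.log (s.w i / P.k) +
          if i = i₀ then 2 / 5 * (P.κ u : ℝ) else 0) ≤
          ∑ i ∈ T, (P.c i : ℝ) *
            Real.log ((s.w i + P.a i u * (s.w i * P.κ u / P.c i) : ℕ) / P.k) := by
        refine Finset.sum_le_sum fun i hi => ?_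
        have hw := h.light hβ i (Finset.mem_range.1 (hT.subset hi)) ((hle i hi).trans hp)
        have hw0 : (0 : ℝ) < s.w i := by exact_mod_cast hk.trans_le hw
        split_ifs with hii
        · subst hii
          have ha : P.a i u = 1 := le_antisymm (hP.le_one _ _) (by omega)
          rw [ha, one_mul]
          have := (hle i hi).trans hp
          -- Here `c i ≤ price T ≤ β < κ u * k`; the last inequality is why cheap elements do not
          -- count as bad.
          exact gain_step hk hw hκ hκ₀ (by rw [mul_comm]; omega)
        · rw [add_zero]
          refine mul_le_mul_of_nonneg_left (Real.log_le_log (by positivity) ?_) (Nat.cast_nonneg _)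
          gcongr
          omega
      rw [Finset.sum_add_distrib, Finset.sum_ite_eq' T i₀, if_pos hi₀] at h2
      push_cast at h2 ⊢
      linarith

/-! ### Bounds for a whole run -/

theorem size_lt_size_of_two_mul_le {x y : ℕ} (hy : 0 < y) (h : 2 * x ≤ y) :
    Nat.size x < Nat.size y := by
  rw [Nat.lt_size]
  rcases Nat.eq_zero_or_pos x with rfl | hx
  · simpa [Nat.one_le_iff_ne_zero] using hy.ne'
  · obtain ⟨z, hz⟩ := Nat.exists_eq_succ_of_ne_zero (Nat.size_pos.2 hx).ne'
    have : 2 ^ z ≤ x := Nat.lt_size.1 (by omega)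
    rw [hz, Nat.succ_eq_add_one, pow_succ]
    omega

theorem run_zero (R : Finset ℕ) : P.run R 0 = ⟨0, 0, fun _ => 0⟩ := by
  rw [run, Function.iterate_zero_apply]

theorem run_succ (R : Finset ℕ) (n : ℕ) : P.run R (n + 1) = P.step R (P.run R n) :=
  Function.iterate_succ_apply' _ _ _

/-- What holds after `n` mistakes. -/
structure History (P : Problem) (T R : Finset ℕ) (n : ℕ) : Prop where
  inv : P.Inv T (P.run R n)
  cost : ∑ j ∈ Finset.range n, P.κ (P.select R (P.run R j)) ≤
    (P.run R n).M + (8 * P.L + 2) * (P.run R n).β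
  count : n ≤ P.k * (8 * P.L + 1) + (P.k * (8 * P.L + 1) + 1) * Nat.size (P.run R n).β
  weight : ∀ i < P.m, (P.run R n).w i ≤ P.k * 2 ^ n

/-- Guesses at least double, so the costs of earlier phases are dominated by a geometric series and
the number of phases by the binary length of the guess. A single update at most doubles a weight. -/
theorem history {T R : Finset ℕ} (hP : P.Valid) (hT : P.Covers T R) (hL : Real.log P.m ≤ P.L)
    {n : ℕ} (hn : ∀ j < n, P.select R (P.run R j) < P.N) : P.History T R n := by
  suffices H : P.Inv T (P.run R n) ∧
      ∑ j ∈ Finset.range n, P.κ (P.select R (P.run R j)) ≤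
        (P.run R n).M + (8 * P.L + 2) * (P.run R n).β ∧
      -- `r` counts the mistakes charged to the current guess; each costs more than `β / k`.
      (∃ r, r * (P.run R n).β ≤ P.k * (P.run R n).M ∧ ((P.run R n).β = 0 → r = 0) ∧
        n ≤ r + (P.k * (8 * P.L + 1) + 1) * Nat.size (P.run R n).β) ∧
      ∀ i < P.m, (P.run R n).w i ≤ P.k * 2 ^ n by
    obtain ⟨h1, h2, ⟨r, h3, h4, h5⟩, h6⟩ := H
    refine ⟨h1, h2, h5.trans (Nat.add_le_add_right ?_ _), h6⟩
    rcases Nat.eq_zero_or_pos (P.run R n).β with h0 | h0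
    · simp [h4 h0]
    · refine Nat.le_of_mul_le_mul_right (h3.trans ?_) h0
      have := Nat.mul_le_mul_left P.k h1.mistakes
      linarith
  induction n with
  | zero =>
    refine ⟨⟨?_, ?_, ?_, ?_, ?_, ?_⟩, ?_, ⟨0, ?_, ?_, ?_⟩, ?_⟩ <;> simp [run]
  | succ n ih =>
    obtain ⟨h1, h2, ⟨r, h3, h4, h5⟩, h6⟩ := ih fun j hj => hn j (by omega)
    have hlt := hn n (by omega)
    obtain ⟨hR, hbad⟩ := select_spec hlt
    have hstep : P.run R (n + 1) = P.update (P.run R n) (P.select R (P.run R n)) := by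
      rw [run_succ, step, if_pos hlt]
    rw [hstep]
    set s := P.run R n
    set u := P.select R s with hu
    refine ⟨h1.update hP hT hL hlt hR hbad, ?_⟩
    rw [Finset.sum_range_succ, ← hu]
    obtain ⟨hb1, hb2⟩ := bad_ne_zero.1 hbad
    have hκ : 0 < P.κ u := Nat.pos_of_ne_zero fun h => by simp [h] at hb1
    have hm := h1.mistakes
    unfold Problem.update
    split_ifs with hr
    · dsimp only
      set μ := s.β + (P.κ u - s.β)
      have hμ1 : s.β ≤ μ := by omega
      have hμ2 : P.κ u ≤ μ := by omega
      refine ⟨?_, ⟨0, by simp, by simp, ?_⟩, fun i _ => ?_⟩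
      -- The former cost is at most `(16 * L + 3) * β`. The element that causes the restart adds at
      -- most `μ`, and `(16 * L + 4) * μ` is the allowance of the new guess `2 * μ`.
      · have h7 := Nat.mul_le_mul_left (16 * P.L + 3) hμ1
        have h8 : (8 * P.L + 2) * (2 * μ) = (16 * P.L + 3) * μ + μ := by ring
        have h9 : (16 * P.L + 3) * s.β = 8 * s.β * P.L + s.β + (8 * P.L + 2) * s.β := by ring
        omega
      · have hs : Nat.size s.β < Nat.size (2 * μ) := size_lt_size_of_two_mul_le (by omega) (by omega)
        have hr : r ≤ P.k * (8 * P.L + 1) := by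
          rcases Nat.eq_zero_or_pos s.β with h0 | h0
          · simp [h4 h0]
          · refine Nat.le_of_mul_le_mul_right (h3.trans ?_) h0
            have := Nat.mul_le_mul_left P.k hm
            linarith
        have := Nat.mul_le_mul_left (P.k * (8 * P.L + 1) + 1) (Nat.succ_le_of_lt hs)
        rw [Nat.succ_eq_add_one, mul_add_one] at this
        omega
      · split_ifs
        · simp
        · exact Nat.le_mul_of_pos_right _ (by positivity)
    · push Not at hr
      dsimp only
      refine ⟨by omega, ⟨r + 1, ?_, fun h => by omega, by omega⟩, fun i hi => ?_⟩
      · rw [add_one_mul, mul_add]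
        have : s.β ≤ P.k * P.κ u := by rw [mul_comm]; exact hb1.le
        omega
      · have h7 := h6 i hi
        have h8 : P.a i u * (s.w i * P.κ u / P.c i) ≤ s.w i := by
          by_cases ha : P.a i u = 0
          · simp [ha]
          · have h9 := (hP.cheapest_spec hlt).2.2 i hi ha
            have h10 : s.w i * P.κ u / P.c i ≤ s.w i := by
              refine Nat.div_le_of_le_mul ?_
              rw [mul_comm]
              exact Nat.mul_le_mul_right _ h9
            exact (Nat.mul_le_mul (hP.le_one i u) h10).trans (by simp)
        rw [pow_succ, ← mul_assoc]
        omega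

/-! ### Termination and the leave-one-out argument -/

theorem Valid.covers_range (hP : P.Valid) {R : Finset ℕ} (hR : R ⊆ Finset.range P.N) :
    P.Covers (Finset.range P.m) R :=
  ⟨subset_rfl, fun u hu => by
    simpa using hP.covered u (Finset.mem_range.1 (hR hu))⟩

/-- Taking all sets as the cover in `history` bounds the number of mistakes by `fuel`, without
reference to the optimum. Once no bad element is left the state is a fixed point, so running longer
changes nothing. -/
theorem exists_halt {R : Finset ℕ} (hP : P.Valid) (hR : R ⊆ Finset.range P.N)
    (hL : Real.log P.m ≤ P.L) : ∃ n ≤ P.fuel, P.N ≤ P.select R (P.run R n) ∧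
      (∀ j < n, P.select R (P.run R j) < P.N) ∧ P.final R = P.run R n := by
  classical
  have hex : ∃ n, P.N ≤ P.select R (P.run R n) := by
    by_contra hne
    push Not at hne
    have h := history (n := P.fuel + 1) hP (hP.covers_range hR) hL fun j _ => hne j
    have h1 := h.count
    have h2 := Nat.mul_le_mul_left (P.k * (8 * P.L + 1) + 1) (Nat.size_le_size h.inv.guess)
    have h3 : P.fuel = P.k * (8 * P.L + 1) + 1 + (P.k * (8 * P.L + 1) + 1) *
        Nat.size (2 * P.price (Finset.range P.m)) := by rw [fuel, mul_add, mul_one]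
    omega
  have hfind := Nat.find_spec hex
  have hmin : ∀ j < Nat.find hex, P.select R (P.run R j) < P.N := fun j hj =>
    not_le.1 (Nat.find_min hex hj)
  have hle : Nat.find hex ≤ P.fuel := by
    have h := history hP (hP.covers_range hR) hL hmin
    have h1 := h.count
    have h2 := Nat.mul_le_mul_left (P.k * (8 * P.L + 1) + 1) (Nat.size_le_size h.inv.guess)
    unfold fuel
    rw [mul_add, mul_one]
    omega
  refine ⟨Nat.find hex, hle, hfind, hmin, ?_⟩
  have : ∀ d, P.run R (Nat.find hex + d) = P.run R (Nat.find hex) := by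
    intro d
    induction d with
    | zero => rfl
    | succ d ih => rw [← add_assoc, run_succ, ih, step, if_neg (not_lt.2 hfind)]
  obtain ⟨d, hd⟩ := Nat.exists_eq_add_of_le hle
  rw [final, hd, this]

theorem inv_final {T R : Finset ℕ} (hP : P.Valid) (hR : R ⊆ Finset.range P.N)
    (hT : P.Covers T R) (hL : Real.log P.m ≤ P.L) : P.Inv T (P.final R) := by
  obtain ⟨n, -, -, h1, h2⟩ := exists_halt hP hR hL
  rw [h2]
  exact (history hP hT hL h1).inv

theorem bad_final {R : Finset ℕ} (hP : P.Valid) (hR : R ⊆ Finset.range P.N)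
    (hL : Real.log P.m ≤ P.L) {u : ℕ} (hu : u ∈ R) : P.bad (P.final R) u = 0 := by
  obtain ⟨n, -, h1, -, h2⟩ := exists_halt hP hR hL
  rw [h2]
  exact bad_eq_zero_of_select h1 (Finset.mem_range.1 (hR hu)) hu

/-- If `v` is never selected, both runs pass through the same states and halt at the same time. At
that time no element of `R` is bad, in particular not `v`. -/
theorem final_erase {R : Finset ℕ} (hP : P.Valid) (hR : R ⊆ Finset.range P.N)
    (hL : Real.log P.m ≤ P.L) {n : ℕ} (hn : P.N ≤ P.select R (P.run R n))
    (hlt : ∀ j < n, P.select R (P.run R j) < P.N) {v : ℕ} (hv : v ∈ R)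
    (hsel : ∀ j < n, P.select R (P.run R j) ≠ v) : P.bad (P.final (R.erase v)) v = 0 := by
  have hrun : ∀ j ≤ n, P.run (R.erase v) j = P.run R j := by
    intro j
    induction j with
    | zero => intro _; rw [run_zero, run_zero]
    | succ j ih =>
      intro hj
      rw [run_succ, run_succ, ih (by omega), step, step, select_erase (hsel j (by omega))]
  have hvN := Finset.mem_range.1 (hR hv)
  have hn' : P.N ≤ P.select (R.erase v) (P.run (R.erase v) n) := by
    rw [hrun n le_rfl, select_erase (by omega)]
    exact hn
  obtain ⟨n', -, h1, h2, h3⟩ := exists_halt hP ((Finset.erase_subset v R).trans hR) hL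
  have : n' = n := by
    rcases lt_trichotomy n' n with h | h | h
    · have := hlt n' h
      rw [← hrun n' h.le] at this
      rw [select_erase] at h1
      · omega
      · rw [hrun n' h.le]; exact hsel n' h
    · exact h
    · exact absurd (h2 n h) (not_lt.2 hn')
  rw [h3, this, hrun n le_rfl]
  exact bad_eq_zero_of_select hn hvN hv

/-- The leave-one-out bound. -/
theorem sum_bad_erase_le {T R : Finset ℕ} (hP : P.Valid) (hR : R ⊆ Finset.range P.N)
    (hT : P.Covers T R) (hL : Real.log P.m ≤ P.L) :
    ∑ v ∈ R with P.bad (P.final (R.erase v)) v ≠ 0, P.κ v ≤ (32 * P.L + 6) * P.price T := by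
  obtain ⟨n, -, h1, h2, -⟩ := exists_halt hP hR hL
  have h := history hP hT hL h2
  calc ∑ v ∈ R with P.bad (P.final (R.erase v)) v ≠ 0, P.κ v
      ≤ ∑ v ∈ (Finset.range n).image fun j => P.select R (P.run R j), P.κ v := by
        -- By `final_erase`, an element that is bad when left out has been selected at some time in
        -- the run on `R`.
        refine Finset.sum_le_sum_of_subset fun v hv => ?_
        rw [Finset.mem_filter] at hv
        by_contra hne
        refine hv.2 (final_erase hP hR hL h1 h2 hv.1 fun j hj he => hne ?_)
        exact Finset.mem_image.2 ⟨j, Finset.mem_range.2 hj, he⟩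
    _ ≤ ∑ j ∈ Finset.range n, P.κ (P.select R (P.run R j)) :=
        Finset.sum_image_le_of_nonneg fun _ _ => Nat.zero_le _
    _ ≤ (P.run R n).M + (8 * P.L + 2) * (P.run R n).β := h.cost
    _ ≤ (16 * P.L + 3) * (P.run R n).β := by
        have := h.inv.mistakes
        linarith
    _ ≤ (16 * P.L + 3) * (2 * P.price T) := Nat.mul_le_mul_left _ h.inv.guess
    _ = _ := by ring

end Problem

end SetCover

namespace SetCover

/-! ### Uniform expectations -/

theorem card_filter_mul_lt {n A B : ℕ} (hA : 0 < A) :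
    ((Finset.range n).filter fun x => x * A < B).card = min n ⌈(B / A : ℝ)⌉₊ := by
  have hA' : (0 : ℝ) < A := by exact_mod_cast hA
  have : ((Finset.range n).filter fun x => x * A < B) = Finset.range (min n ⌈(B / A : ℝ)⌉₊) := by
    ext x
    simp only [Finset.mem_filter, Finset.mem_range, lt_min_iff, Nat.lt_ceil, lt_div_iff₀ hA']
    exact and_congr_right fun _ => by exact_mod_cast Iff.rfl
  rw [this, Finset.card_range]

theorem expect_indicator {n : ℕ} (p : ℕ → Prop) [DecidablePred p] :
    𝔼 x : Fin n, ((if p x then 1 else 0 : ℕ) : ℝ) =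
      (((Finset.range n).filter p).card : ℝ) / n := by
  rw [Fintype.expect_eq_sum_div_card, Fintype.card_fin, Finset.card_filter, Nat.cast_sum,
    Fin.sum_univ_eq_sum_range fun x => ((if p x then 1 else 0 : ℕ) : ℝ)]

theorem expect_prod {m n : ℕ} (h : Fin m → Fin n → ℝ) :
    𝔼 ρ : Fin m → Fin n, ∏ i, h i (ρ i) = ∏ i, 𝔼 x, h i x := by
  simp only [Fintype.expect_eq_sum_div_card, Finset.prod_div_distrib, Fintype.prod_sum]
  simp

theorem expect_apply {m n : ℕ} [NeZero n] (i : Fin m) (h : Fin n → ℝ) :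
    𝔼 ρ : Fin m → Fin n, h (ρ i) = 𝔼 x, h x := by
  have := expect_prod fun j x => if j = i then h x else 1
  have h1 : ∏ j : Fin m, (𝔼 x, if j = i then h x else 1) = 𝔼 x, h x := by
    rw [Finset.prod_eq_single i (fun j _ hj => by simp [hj]) (by simp)]
    simp
  rw [h1] at this
  simpa using this

/-- The coordinates outside the range of `e` are independent of the others and average out, so
surplus random bits are harmless. -/
theorem expect_restrict {ι κ : Type} [Fintype ι] [Fintype κ] [DecidableEq ι] [DecidableEq κ]
    (e : κ ↪ ι) (G : (κ → Bool) → ℝ) :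
    𝔼 ω : ι → Bool, G (ω ∘ e) = 𝔼 η : κ → Bool, G η := by
  classical
  let E : (ι → Bool) ≃ (κ → Bool) × ({x : ι // ¬x ∈ Set.range e} → Bool) :=
    (Equiv.piEquivPiSubtypeProd (· ∈ Set.range e) fun _ => Bool).trans
      (Equiv.prodCongr (Equiv.arrowCongr (Equiv.ofInjective e e.injective).symm (Equiv.refl Bool))
        (Equiv.refl _))
  have hE : ∀ ω, (E ω).1 = ω ∘ e := fun ω => by
    funext x
    simp [E]
  rw [Fintype.expect_equiv E _ (fun p => G p.1) fun ω => by rw [hE],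
    ← Finset.univ_product_univ, Finset.expect_product]
  simp

/-- The number with the binary digits `ω (i * m), …, ω (i * m + m - 1)`, lowest first. -/
def block (m : ℕ) (ω : ℕ → ℕ) (i : ℕ) : ℕ := ∑ j ∈ Finset.range m, ω (i * m + j) * 2 ^ j

/-- Disjoint blocks of `m` fair bits are the binary digits of independent uniform numbers below `2 ^
m`; disjointness is the injectivity of `(i, j) ↦ i * m + j`. -/
theorem expect_block {m r : ℕ} (hr : m * m ≤ r) (F : (ℕ → ℕ) → ℝ)
    (hF : ∀ z z', (∀ i < m, z i = z' i) → F z = F z') :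
    𝔼 ω : Fin r → Bool, F (block m fun j => if h : j < r then (ω ⟨j, h⟩).toNat else 0) =
      𝔼 ρ : Fin m → Fin (2 ^ m), F fun i => if h : i < m then ρ ⟨i, h⟩ else 0 := by
  have hlt : ∀ i j : Fin m, (i : ℕ) * m + j < m * m := fun i j => by
    have := Nat.mul_le_mul_right m (Nat.succ_le_of_lt i.2)
    rw [Nat.succ_mul] at this
    have := j.2
    omega
  let e : Fin m × Fin m ↪ Fin r :=
    ⟨fun p => ⟨p.1 * m + p.2, (hlt p.1 p.2).trans_le hr⟩, fun p q hpq => by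
      have h : (p.1 : ℕ) * m + p.2 = q.1 * m + q.2 := by simpa using hpq
      have hp := p.2.2
      have hq := q.2.2
      have hm : 0 < m := by omega
      have h1 := congrArg (· / m) h
      have h2 := congrArg (· % m) h
      simp only [mul_comm _ m, Nat.mul_add_div hm, Nat.mul_add_mod,
        Nat.div_eq_of_lt hp, Nat.div_eq_of_lt hq, Nat.mod_eq_of_lt hp, Nat.mod_eq_of_lt hq,
        add_zero] at h1 h2
      exact Prod.ext (Fin.ext h1) (Fin.ext h2)⟩
  let E : (Fin m × Fin m → Bool) ≃ (Fin m → Fin (2 ^ m)) :=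
    (Equiv.curry _ _ _).trans (Equiv.piCongrRight fun _ =>
      (Equiv.arrowCongr (Equiv.refl _) finTwoEquiv.symm).trans finFunctionFinEquiv)
  have hE : ∀ η i, ((E η i : Fin (2 ^ m)) : ℕ) = ∑ j : Fin m, (η (i, j)).toNat * 2 ^ (j : ℕ) := by
    intro η i
    simp only [E, Equiv.trans_apply, Equiv.piCongrRight_apply, Pi.map_apply,
      finFunctionFinEquiv_apply]
    refine Finset.sum_congr rfl fun j _ => ?_
    congr 1
    cases h : η (i, j) <;> simp [Equiv.arrowCongr, finTwoEquiv, Function.curry, h]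
  rw [← Fintype.expect_equiv E (fun η => F fun i => if h : i < m then (E η ⟨i, h⟩ : ℕ) else 0) _
    fun η => rfl, ← expect_restrict e]
  refine Finset.expect_congr rfl fun ω _ => hF _ _ fun i hi => ?_
  rw [dif_pos hi, hE, block, Finset.sum_range]
  refine Finset.sum_congr rfl fun j _ => ?_
  rw [dif_pos ((hlt ⟨i, hi⟩ j).trans_le hr)]
  rfl

/-- Averaging over the sample and a further element is averaging over larger samples. -/
theorem expect_sum_sdiff_le {α : Type} [DecidableEq α] (U : Finset α) (k : ℕ)
    (hk : k ≤ U.card) (f : Finset α → α → ℝ) {B : ℝ}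
    (hf : ∀ V ∈ U.powersetCard (k + 1), ∑ v ∈ V, f (V.erase v) v ≤ B) :
    𝔼 W ∈ U.powersetCard k, ∑ u ∈ U \ W, f W u ≤ (U.card - k) / (k + 1) * B := by
  have h1 : ∑ W ∈ U.powersetCard k, ∑ u ∈ U \ W, f W u =
      ∑ V ∈ U.powersetCard (k + 1), ∑ v ∈ V, f (V.erase v) v := by
    -- A pair `(W, u)` with `u` outside `W` corresponds to `(V, v) = (insert u W, u)`.
    rw [Finset.sum_sigma', Finset.sum_sigma']
    refine Finset.sum_bij' (fun p _ => ⟨insert p.2 p.1, p.2⟩) (fun p _ => ⟨p.1.erase p.2, p.2⟩)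
      ?_ ?_ ?_ ?_ ?_
    · rintro ⟨W, u⟩ h
      simp only [Finset.mem_sigma, Finset.mem_powersetCard, Finset.mem_sdiff] at h ⊢
      exact ⟨⟨Finset.insert_subset h.2.1 h.1.1, by
        rw [Finset.card_insert_of_notMem h.2.2, h.1.2]⟩, Finset.mem_insert_self _ _⟩
    · rintro ⟨V, v⟩ h
      simp only [Finset.mem_sigma, Finset.mem_powersetCard, Finset.mem_sdiff] at h ⊢
      exact ⟨⟨(Finset.erase_subset _ _).trans h.1.1, by
        rw [Finset.card_erase_of_mem h.2, h.1.2]; rfl⟩, h.1.1 h.2, Finset.notMem_erase _ _⟩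
    · rintro ⟨W, u⟩ h
      simp only [Finset.mem_sigma, Finset.mem_sdiff] at h
      simp [Finset.erase_insert h.2.2]
    · rintro ⟨V, v⟩ h
      simp only [Finset.mem_sigma] at h
      simp [Finset.insert_erase h.2]
    · rintro ⟨W, u⟩ h
      simp only [Finset.mem_sigma, Finset.mem_sdiff] at h
      simp [Finset.erase_insert h.2.2]
  have h2 : (0 : ℝ) < U.card.choose k := by exact_mod_cast Nat.choose_pos hk
  rw [Finset.expect_eq_sum_div_card, h1, Finset.card_powersetCard, div_le_iff₀ h2]
  refine (Finset.sum_le_card_nsmul _ _ B hf).trans (le_of_eq ?_)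
  rw [Finset.card_powersetCard, nsmul_eq_mul]
  have h3 : (U.card.choose (k + 1) : ℝ) * (k + 1) = U.card.choose k * (U.card - k) := by
    rw [← Nat.cast_sub hk]
    exact_mod_cast Nat.choose_succ_right_eq U.card k
  field_simp
  linear_combination B * h3

/-! ### Rounding the fractional cover -/

namespace Problem

variable (P : Problem)

/-- Whether set `i` is chosen when its random number is `x`. -/
def chosen (s : Learner) (i x : ℕ) : ℕ :=
  if x * P.total s * P.c i < 8 * P.L * s.β * s.w i * 2 ^ P.m then 1 else 0

/-- The first chosen set that contains `u`, and `m` if there is none. -/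
def hitter (s : Learner) (z : ℕ → ℕ) (u : ℕ) : ℕ :=
  firstIdx P.m fun i => P.a i u * P.chosen s i (z i)

/-- The set that is assigned to `u`, with random numbers `z`. -/
def assign (s : Learner) (z : ℕ → ℕ) (u : ℕ) : ℕ :=
  if P.hitter s z u < P.m then P.hitter s z u else P.cheapest u

variable {P}

theorem chosen_le_one (s : Learner) (i x : ℕ) : P.chosen s i x ≤ 1 := by
  unfold chosen; split_ifs <;> simp

theorem hitter_congr (s : Learner) {z z' : ℕ → ℕ} (h : ∀ i < P.m, z i = z' i) (u : ℕ) :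
    P.hitter s z u = P.hitter s z' u := by
  unfold hitter firstIdx
  refine Finset.sum_congr rfl fun j _ => Finset.prod_congr rfl fun i hi => ?_
  dsimp only
  rw [h i (Finset.mem_range.1 hi)]

theorem assign_congr (s : Learner) {z z' : ℕ → ℕ} (h : ∀ i < P.m, z i = z' i) (u : ℕ) :
    P.assign s z u = P.assign s z' u := by
  rw [assign, assign, hitter_congr s h]

theorem Valid.assign_spec (hP : P.Valid) (s : Learner) (z : ℕ → ℕ) {u : ℕ} (hu : u < P.N) :
    P.assign s z u < P.m ∧ P.a (P.assign s z u) u ≠ 0 := by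
  unfold assign
  split_ifs with h
  · exact ⟨h, left_ne_zero_of_mul (firstIdx_spec (firstIdx_lt_iff.1 h)).2.1⟩
  · exact ⟨(hP.cheapest_spec hu).1, (hP.cheapest_spec hu).2.1⟩

/-- The product is 1 if no chosen set contains `u`, which is when the cheapest set is bought. In
product form its expectation factors by independence. -/
theorem price_image_assign_le (s : Learner) (z : ℕ → ℕ) (U : Finset ℕ) :
    P.price (U.image (P.assign s z)) ≤
      ∑ i ∈ Finset.range P.m, P.c i * P.chosen s i (z i) +
        ∑ u ∈ U, P.κ u * ∏ i ∈ Finset.range P.m, (1 - P.a i u * P.chosen s i (z i)) := by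
  classical
  set F := (Finset.range P.m).filter fun i => P.chosen s i (z i) ≠ 0
  set U' := U.filter fun u => ¬P.hitter s z u < P.m
  have hsub : U.image (P.assign s z) ⊆ F ∪ U'.image P.cheapest := by
    intro i hi
    obtain ⟨u, hu, rfl⟩ := Finset.mem_image.1 hi
    rw [Finset.mem_union]
    unfold assign
    split_ifs with h
    · exact Or.inl (Finset.mem_filter.2 ⟨Finset.mem_range.2 h,
        right_ne_zero_of_mul (firstIdx_spec (firstIdx_lt_iff.1 h)).2.1⟩)
    · exact Or.inr (Finset.mem_image.2 ⟨u, Finset.mem_filter.2 ⟨hu, h⟩, rfl⟩)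
  have h1 : P.price F ≤ ∑ i ∈ Finset.range P.m, P.c i * P.chosen s i (z i) := by
    rw [price, Finset.sum_filter]
    refine Finset.sum_le_sum fun i _ => ?_
    split_ifs with h
    · exact Nat.le_mul_of_pos_right _ (Nat.pos_of_ne_zero h)
    · exact Nat.zero_le _
  have h2 : P.price (U'.image P.cheapest) ≤
      ∑ u ∈ U, P.κ u * ∏ i ∈ Finset.range P.m, (1 - P.a i u * P.chosen s i (z i)) := by
    refine (Finset.sum_image_le_of_nonneg (f := P.c) fun _ _ => Nat.zero_le _).trans ?_
    rw [Finset.sum_filter]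
    refine Finset.sum_le_sum fun u _ => ?_
    by_cases h : P.hitter s z u < P.m
    · rw [if_neg (not_not.2 h)]
      exact Nat.zero_le _
    · rw [if_pos h, Finset.prod_eq_one, mul_one]
      · rfl
      · intro i hi
        by_contra hne
        exact h (firstIdx_lt_iff.2 ⟨i, Finset.mem_range.1 hi, fun h0 => hne (by rw [h0, Nat.sub_zero])⟩)
  calc P.price (U.image (P.assign s z)) ≤ P.price (F ∪ U'.image P.cheapest) :=
        Finset.sum_le_sum_of_subset hsub
    _ ≤ P.price F + P.price (U'.image P.cheapest) := by
        have := Finset.sum_union_inter (s₁ := F) (s₂ := U'.image P.cheapest) (f := P.c)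
        unfold price
        omega
    _ ≤ _ := add_le_add h1 h2

/-- The probability that set `i` is chosen. -/
noncomputable def hit (P : Problem) (s : Learner) (i : ℕ) : ℝ := 𝔼 x : Fin (2 ^ P.m), (P.chosen s i x : ℝ)

theorem hit_eq (s : Learner) (i : ℕ) : P.hit s i = (((Finset.range (2 ^ P.m)).filter fun x =>
    x * (P.total s * P.c i) < 8 * P.L * s.β * s.w i * 2 ^ P.m).card : ℝ) / (2 : ℝ) ^ P.m := by
  unfold hit chosen
  rw [expect_indicator fun x => x * P.total s * P.c i < 8 * P.L * s.β * s.w i * 2 ^ P.m]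
  simp only [mul_assoc]
  push_cast
  rfl

theorem hit_nonneg (s : Learner) (i : ℕ) : 0 ≤ P.hit s i := by
  rw [hit_eq]; positivity

theorem hit_le_one (s : Learner) (i : ℕ) : P.hit s i ≤ 1 := by
  rw [hit_eq, div_le_one (by positivity)]
  have := Finset.card_filter_le (Finset.range (2 ^ P.m)) fun x =>
    x * (P.total s * P.c i) < 8 * P.L * s.β * s.w i * 2 ^ P.m
  rw [Finset.card_range] at this
  exact_mod_cast this

/-- The probability is that of the boosted fractional solution, rounded up to a multiple of `2 ^
(-m)` and capped at 1. The rounding error costs at most `β / 2 ^ m`, as only sets with `c i ≤ β`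
have positive weight. -/
theorem cost_mul_hit_le {s : Learner} (hheavy : 0 < s.β → ∀ i < P.m, s.β < P.c i → s.w i = 0)
    {i : ℕ} (hi : i < P.m) :
    P.c i * P.hit s i ≤ 8 * P.L * s.β * (s.w i / P.total s) + s.β / 2 ^ P.m := by
  by_cases h0 : s.β = 0 ∨ s.w i = 0
  · have : P.hit s i = 0 := by
      rw [hit_eq]
      rcases h0 with h0 | h0 <;> simp [h0]
    rw [this, mul_zero]
    positivity
  push Not at h0
  have hc : P.c i ≤ s.β := by
    by_contra h
    exact h0.2 (hheavy (Nat.pos_of_ne_zero h0.1) i hi (not_le.1 h))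
  have hw : s.w i ≤ P.total s :=
    Finset.single_le_sum (f := s.w) (fun _ _ => Nat.zero_le _) (Finset.mem_range.2 hi)
  have ht : (0 : ℝ) < P.total s := by
    have := Nat.pos_of_ne_zero h0.2
    exact_mod_cast (by omega : 0 < P.total s)
  rcases Nat.eq_zero_or_pos (P.c i) with hc0 | hc0
  · rw [hc0, Nat.cast_zero, zero_mul]
    positivity
  have hc0' : (0 : ℝ) < P.c i := by exact_mod_cast hc0
  have hc' : (P.c i : ℝ) ≤ s.β := by exact_mod_cast hc
  rw [hit_eq, card_filter_mul_lt (Nat.mul_pos (by exact_mod_cast ht) hc0)]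
  have h1 : ((min (2 ^ P.m) ⌈((8 * P.L * s.β * s.w i * 2 ^ P.m : ℕ) : ℝ) /
      ((P.total s * P.c i : ℕ) : ℝ)⌉₊ : ℕ) : ℝ) ≤
      ((8 * P.L * s.β * s.w i * 2 ^ P.m : ℕ) : ℝ) / ((P.total s * P.c i : ℕ) : ℝ) + 1 :=
    (Nat.cast_le.2 (min_le_right _ _)).trans (Nat.ceil_lt_add_one (by positivity)).le
  have h2 := mul_le_mul_of_nonneg_left (div_le_div_of_nonneg_right h1
    (show (0 : ℝ) ≤ 2 ^ P.m by positivity)) hc0'.le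
  refine h2.trans ?_
  push_cast
  have h3 : (P.c i : ℝ) * ((8 * P.L * s.β * s.w i * 2 ^ P.m / (P.total s * P.c i) + 1) / 2 ^ P.m)
      = 8 * P.L * s.β * (s.w i / P.total s) + P.c i / 2 ^ P.m := by
    field_simp
  rw [h3]
  gcongr

theorem sum_cost_mul_hit_le {s : Learner}
    (hheavy : 0 < s.β → ∀ i < P.m, s.β < P.c i → s.w i = 0) :
    ∑ i ∈ Finset.range P.m, P.c i * P.hit s i ≤ (8 * P.L + 1) * s.β := by
  refine (Finset.sum_le_sum fun i hi => cost_mul_hit_le hheavy (Finset.mem_range.1 hi)).trans ?_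
  rw [Finset.sum_add_distrib, ← Finset.mul_sum, ← Finset.sum_div, ← Nat.cast_sum]
  change 8 * (P.L : ℝ) * s.β * (P.total s / P.total s) + _ ≤ _
  have h1 : (P.total s : ℝ) / P.total s ≤ 1 := div_self_le_one _
  have h2 : (P.m : ℝ) ≤ 2 ^ P.m := by exact_mod_cast P.m.lt_two_pow_self.le
  have h3 : (P.m : ℝ) * (s.β / 2 ^ P.m) ≤ s.β := by
    rw [mul_div_assoc', div_le_iff₀ (by positivity), mul_comm]
    gcongr
  have h4 : 8 * (P.L : ℝ) * s.β * (P.total s / P.total s) ≤ 8 * P.L * s.β :=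
    mul_le_of_le_one_right (by positivity) h1
  simp only [Finset.sum_const, Finset.card_range, nsmul_eq_mul]
  linarith

/-- If a set containing `u` is chosen with certainty, the product vanishes. Otherwise no probability
is capped, their sum is at least `8 * L * load / total ≥ L`, and the product is at most `exp (-L) ≤
1 / k`. -/
theorem prod_miss_le {s : Learner} {u : ℕ} (hP : P.Valid) (hu : u < P.N) (hκ : 0 < P.κ u)
    (hload : P.total s < 8 * P.load s u) (hk : 0 < P.k) (hL : Real.log P.k ≤ P.L) :
    ∏ i ∈ Finset.range P.m, (1 - P.a i u * P.hit s i) ≤ 1 / P.k := by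
  have hk' : (0 : ℝ) < P.k := by exact_mod_cast hk
  have hnn : ∀ i, 0 ≤ 1 - (P.a i u : ℝ) * P.hit s i := fun i => by
    have h1 := hit_le_one (P := P) s i
    have h2 : (P.a i u : ℝ) ≤ 1 := by exact_mod_cast hP.le_one i u
    have := mul_le_one₀ h2 (hit_nonneg s i) h1
    linarith
  by_cases hone : ∃ i ∈ Finset.range P.m, P.a i u ≠ 0 ∧ P.hit s i = 1
  · obtain ⟨i, hi, ha, h1⟩ := hone
    have ha1 : P.a i u = 1 := le_antisymm (hP.le_one _ _) (by omega)
    rw [Finset.prod_eq_zero hi (by rw [ha1, h1]; simp)]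
    positivity
  push Not at hone
  have ht0 : 0 < P.total s := by
    by_contra h
    have h0 : P.total s = 0 := by omega
    have hw := Finset.sum_eq_zero_iff.1 h0
    have : P.load s u = 0 := Finset.sum_eq_zero fun i hi => by simp [hw i hi]
    omega
  have ht : (0 : ℝ) < P.total s := by exact_mod_cast ht0
  have hterm : ∀ i ∈ Finset.range P.m,
      8 * (P.L : ℝ) / P.total s * ((P.a i u * (s.β * s.w i / P.c i) : ℕ) : ℝ) ≤
        P.a i u * P.hit s i := by
    intro i hi
    by_cases ha : P.a i u = 0
    · simp [ha]
    have ha1 : P.a i u = 1 := le_antisymm (hP.le_one _ _) (by omega)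
    have hc := (hP.cheapest_spec hu).2.2 i (Finset.mem_range.1 hi) ha
    have hc0 : 0 < P.c i := by omega
    have hc0' : (0 : ℝ) < P.c i := by exact_mod_cast hc0
    have hne := hone i hi ha
    rw [ha1, one_mul, Nat.cast_one, one_mul]
    rw [hit_eq, card_filter_mul_lt (Nat.mul_pos ht0 hc0)] at hne ⊢
    have hlt : ¬(2 ^ P.m ≤ ⌈((8 * P.L * s.β * s.w i * 2 ^ P.m : ℕ) : ℝ) /
      ((P.total s * P.c i : ℕ) : ℝ)⌉₊) := fun h => hne (by
        rw [min_eq_left h]; push_cast; exact div_self (by positivity))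
    rw [min_eq_right (not_le.1 hlt).le]
    have h1 := Nat.le_ceil (((8 * P.L * s.β * s.w i * 2 ^ P.m : ℕ) : ℝ) /
      ((P.total s * P.c i : ℕ) : ℝ))
    rw [le_div_iff₀ (by positivity)]
    refine le_trans ?_ h1
    have h2 : ((s.β * s.w i / P.c i : ℕ) : ℝ) ≤ s.β * s.w i / P.c i := by
      simpa using Nat.cast_div_le (α := ℝ) (m := s.β * s.w i) (n := P.c i)
    calc 8 * (P.L : ℝ) / P.total s * ((s.β * s.w i / P.c i : ℕ) : ℝ) * 2 ^ P.m
        ≤ 8 * (P.L : ℝ) / P.total s * (s.β * s.w i / P.c i) * 2 ^ P.m := by gcongr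
      _ = _ := by push_cast; field_simp
  have hsum := Finset.sum_le_sum hterm
  rw [← Finset.mul_sum, ← Nat.cast_sum] at hsum
  change 8 * (P.L : ℝ) / P.total s * P.load s u ≤ _ at hsum
  have hL0 : (P.L : ℝ) ≤ 8 * (P.L : ℝ) / P.total s * P.load s u := by
    have h8 : (P.total s : ℝ) ≤ 8 * P.load s u := by exact_mod_cast hload.le
    rw [div_mul_eq_mul_div, le_div_iff₀ ht]
    have : (0 : ℝ) ≤ P.L := Nat.cast_nonneg _
    nlinarith
  calc ∏ i ∈ Finset.range P.m, (1 - P.a i u * P.hit s i)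
      ≤ ∏ i ∈ Finset.range P.m, Real.exp (-(P.a i u * P.hit s i)) :=
        Finset.prod_le_prod (fun i _ => hnn i) fun i _ => by
          have := Real.add_one_le_exp (-(P.a i u * P.hit s i))
          linarith
    _ = Real.exp (-∑ i ∈ Finset.range P.m, P.a i u * P.hit s i) := by
        rw [← Real.exp_sum, Finset.sum_neg_distrib]
    _ ≤ Real.exp (-Real.log P.k) := Real.exp_le_exp.2 (by linarith)
    _ = 1 / P.k := by rw [Real.exp_neg, Real.exp_log hk', one_div]

theorem expect_miss {s : Learner} {u : ℕ} (hP : P.Valid) (i : ℕ) :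
    𝔼 x : Fin (2 ^ P.m), ((1 - P.a i u * P.chosen s i x : ℕ) : ℝ) = 1 - P.a i u * P.hit s i := by
  have : ∀ x : ℕ, ((1 - P.a i u * P.chosen s i x : ℕ) : ℝ) = 1 - P.a i u * P.chosen s i x := by
    intro x
    rw [Nat.cast_sub]
    · simp
    · exact (Nat.mul_le_mul (hP.le_one i u) (chosen_le_one s i x)).trans le_rfl
  simp only [this]
  rw [Finset.expect_sub_distrib, ← Finset.mul_expect]
  simp [hit]

/-- The three terms for `u` stand for the three kinds of elements: those with `κ u * k ≤ β`, the bad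
ones, and those covered well enough to be missed with probability at most `1 / k`. -/
theorem expect_price_assign_le {s : Learner} {U : Finset ℕ} (hP : P.Valid)
    (hheavy : 0 < s.β → ∀ i < P.m, s.β < P.c i → s.w i = 0) (hU : U ⊆ Finset.range P.N)
    (hk : 0 < P.k) (hL : Real.log P.k ≤ P.L) :
    𝔼 ρ : Fin P.m → Fin (2 ^ P.m),
      (P.price (U.image (P.assign s fun i => if h : i < P.m then ρ ⟨i, h⟩ else 0)) : ℝ) ≤
      (8 * P.L + 1) * s.β + ∑ u ∈ U, ((s.β : ℝ) / P.k +
        (if P.bad s u ≠ 0 then (P.κ u : ℝ) else 0) + P.κ u / P.k) := by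
  have hk' : (0 : ℝ) < P.k := by exact_mod_cast hk
  have h1 : ∀ ρ : Fin P.m → Fin (2 ^ P.m),
      (P.price (U.image (P.assign s fun i => if h : i < P.m then ρ ⟨i, h⟩ else 0)) : ℝ) ≤
      ∑ i : Fin P.m, (P.c i : ℝ) * P.chosen s i (ρ i) +
        ∑ u ∈ U, (P.κ u : ℝ) * ∏ i : Fin P.m, ((1 - P.a i u * P.chosen s i (ρ i) : ℕ) : ℝ) := by
    intro ρ
    have := (Nat.cast_le (α := ℝ)).2 (price_image_assign_le (P := P) s
      (fun i => if h : i < P.m then ρ ⟨i, h⟩ else 0) U)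
    simp only [Finset.prod_range, Finset.sum_range, Fin.is_lt, dite_true, Fin.eta] at this
    push_cast [-Nat.cast_sub] at this
    exact this
  refine (Finset.expect_le_expect fun ρ _ => h1 ρ).trans ?_
  rw [Finset.expect_add_distrib, Finset.expect_sum_comm, Finset.expect_sum_comm]
  refine add_le_add ?_ (Finset.sum_le_sum fun u hu => ?_)
  · refine le_trans (le_of_eq ?_) (sum_cost_mul_hit_le hheavy)
    rw [Finset.sum_range]
    refine Finset.sum_congr rfl fun i _ => ?_
    rw [← Finset.mul_expect, expect_apply i fun x => (P.chosen s i x : ℝ), hit]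
  · have huN := Finset.mem_range.1 (hU hu)
    rw [← Finset.mul_expect,
      expect_prod fun i x => ((1 - P.a i u * P.chosen s i x : ℕ) : ℝ)]
    simp only [expect_miss hP]
    rw [← Finset.prod_range fun i => 1 - (P.a i u : ℝ) * P.hit s i]
    have hle : ∏ i ∈ Finset.range P.m, (1 - (P.a i u : ℝ) * P.hit s i) ≤ 1 := by
      refine Finset.prod_le_one (fun i _ => ?_) fun i _ => ?_
      · have h2 : (P.a i u : ℝ) ≤ 1 := by exact_mod_cast hP.le_one i u
        have := mul_le_one₀ h2 (hit_nonneg (P := P) s i) (hit_le_one s i)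
        linarith
      · have := mul_nonneg (Nat.cast_nonneg (α := ℝ) (P.a i u)) (hit_nonneg (P := P) s i)
        linarith
    have hle' := mul_le_of_le_one_right (Nat.cast_nonneg (α := ℝ) (P.κ u)) hle
    have hn1 : (0 : ℝ) ≤ s.β / P.k := by positivity
    have hn2 : (0 : ℝ) ≤ P.κ u / P.k := by positivity
    by_cases htiny : P.κ u * P.k ≤ s.β
    · have : (P.κ u : ℝ) ≤ s.β / P.k := by
        rw [le_div_iff₀ hk']; exact_mod_cast htiny
      have : (0 : ℝ) ≤ if P.bad s u ≠ 0 then (P.κ u : ℝ) else 0 := by split_ifs <;> positivity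
      linarith
    · by_cases hb : P.bad s u ≠ 0
      · rw [if_pos hb]
        linarith
      · rw [if_neg hb]
        have hload : P.total s < 8 * P.load s u := by
          by_contra h
          exact hb (bad_ne_zero.2 ⟨not_le.1 htiny, not_lt.1 h⟩)
        have hκ : 0 < P.κ u := Nat.pos_of_ne_zero fun h => htiny (by simp [h])
        have := mul_le_mul_of_nonneg_left (prod_miss_le hP huN hκ hload hk hL)
          (Nat.cast_nonneg (α := ℝ) (P.κ u))
        rw [mul_one_div] at this
        linarith

end Problem

end SetCover

/-! ### Logarithms, and reduction to integer costs -/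

namespace SetCover

/-- The binary length is at most `1 + log₂ x`, and `1 / log 2 < 3/2`. -/
theorem natSize_le_log {x : ℕ} (hx : 0 < x) : (Nat.size x : ℝ) ≤ 1 + 3 / 2 * Real.log x := by
  obtain ⟨z, hz⟩ := Nat.exists_eq_succ_of_ne_zero (Nat.size_pos.2 hx).ne'
  have h1 : 2 ^ z ≤ x := Nat.lt_size.1 (by omega)
  have h2 : (z : ℝ) * Real.log 2 ≤ Real.log x := by
    rw [← Real.log_pow]
    exact Real.log_le_log (by positivity) (by exact_mod_cast h1)
  have h3 := Real.log_two_gt_d9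
  have h4 : (0 : ℝ) ≤ z := Nat.cast_nonneg _
  rw [hz]
  push_cast
  nlinarith

theorem log_le_natSize (x : ℕ) : Real.log x ≤ Nat.size x := by
  rcases Nat.eq_zero_or_pos x with rfl | hx
  · simp
  have h1 : (x : ℝ) ≤ 2 ^ Nat.size x := by exact_mod_cast (Nat.lt_size_self x).le
  have h2 := Real.log_le_log (by exact_mod_cast hx) h1
  rw [Real.log_pow] at h2
  have h3 := Real.log_two_lt_d9
  have h4 : (0 : ℝ) ≤ Nat.size x := Nat.cast_nonneg _
  nlinarith

namespace SetSystem

variable (I : SetSystem)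

open Classical in
/-- The incidence matrix, row by row. -/
def incidence (j : ℕ) : ℕ :=
  if ∃ (i : Fin I.m) (u : Fin I.N), j = i * I.N + u ∧ u ∈ I.sets i then 1 else 0

def num (j : ℕ) : ℕ := if h : j < I.m then (I.cost ⟨j, h⟩).num else 0

def den (j : ℕ) : ℕ := if h : j < I.m then (I.cost ⟨j, h⟩).den else 0

/-- A common denominator of the costs. -/
def commonDen : ℕ := ∏ j ∈ Finset.range I.m, I.den j

/-- The covering problem with the costs multiplied by a common denominator. -/
noncomputable def problem (k : ℕ) : Problem where
  m := I.m
  N := I.N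
  k := k
  L := Nat.size I.m + Nat.size k
  a i u := I.incidence (i * I.N + u)
  c j := I.num j * (I.commonDen / I.den j)

/-- A set of elements as a set of natural numbers. -/
def indices {n : ℕ} (W : Finset (Fin n)) : Finset ℕ := W.map Fin.valEmbedding

variable {I}

theorem indices_subset {n : ℕ} (W : Finset (Fin n)) : indices W ⊆ Finset.range n := by
  intro u hu
  obtain ⟨v, -, rfl⟩ := Finset.mem_map.1 hu
  exact Finset.mem_range.2 v.2

theorem mem_indices {n : ℕ} {W : Finset (Fin n)} {u : Fin n} : (u : ℕ) ∈ indices W ↔ u ∈ W := by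
  simp [indices, Fin.val_inj]

theorem incidence_ne_zero {i u : ℕ} (hu : u < I.N) : I.incidence (i * I.N + u) ≠ 0 ↔
    ∃ h : i < I.m, (⟨u, hu⟩ : Fin I.N) ∈ I.sets ⟨i, h⟩ := by
  unfold incidence
  simp only [ne_eq, ite_eq_right_iff, one_ne_zero, imp_false, not_not]
  constructor
  · rintro ⟨i', u', h, hmem⟩
    have hN : 0 < I.N := by omega
    have h1 := congrArg (· / I.N) h
    have h2 := congrArg (· % I.N) h
    simp only [mul_comm _ I.N, Nat.mul_add_div hN, Nat.mul_add_mod, Nat.div_eq_of_lt hu,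
      Nat.div_eq_of_lt u'.2, Nat.mod_eq_of_lt hu, Nat.mod_eq_of_lt u'.2, add_zero] at h1 h2
    subst h1 h2
    exact ⟨i'.2, hmem⟩
  · rintro ⟨h, hmem⟩
    exact ⟨⟨i, h⟩, ⟨u, hu⟩, rfl, hmem⟩

theorem valid_problem (k : ℕ) : (I.problem k).Valid := by
  refine ⟨fun i u => ?_, fun u hu => ?_⟩
  · change I.incidence _ ≤ 1
    unfold incidence
    split_ifs <;> simp
  · obtain ⟨i, hi⟩ := I.covers ⟨u, hu⟩
    exact ⟨i, i.2, (incidence_ne_zero hu).2 ⟨i.2, hi⟩⟩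

theorem den_pos {j : ℕ} (hj : j < I.m) : 0 < I.den j := by
  rw [den, dif_pos hj]; exact NNRat.den_pos _

theorem commonDen_pos : 0 < I.commonDen :=
  Finset.prod_pos fun _ hj => den_pos (Finset.mem_range.1 hj)

/-- The denominator of each cost divides the common one, so the natural-number division is exact.
The scaling factor cancels in the competitive ratio. -/
theorem cost_eq (k : ℕ) (i : Fin I.m) :
    (I.cost i : ℝ) = (I.problem k).c i / I.commonDen := by
  have hd : I.den i ∣ I.commonDen := Finset.dvd_prod_of_mem _ (Finset.mem_range.2 i.2)
  have h1 : (0 : ℝ) < I.den i := by exact_mod_cast den_pos i.2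
  have h2 : (0 : ℝ) < I.commonDen := by exact_mod_cast I.commonDen_pos
  change _ = ((I.num i * (I.commonDen / I.den i) : ℕ) : ℝ) / _
  rw [Nat.cast_mul, Nat.cast_div hd h1.ne']
  have h3 : (I.cost i : ℝ) = I.num i / I.den i := by
    rw [num, den, dif_pos i.2, dif_pos i.2]
    exact NNRat.cast_def _
  rw [h3]
  field_simp

theorem totalCost_eq (k : ℕ) (T : Finset (Fin I.m)) :
    I.totalCost T = (I.problem k).price (indices T) / I.commonDen := by
  unfold totalCost Problem.price indices
  rw [Finset.sum_map, Nat.cast_sum, Finset.sum_div]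
  exact Finset.sum_congr rfl fun i _ => cost_eq k i

theorem exists_opt (U : Finset (Fin I.N)) : ∃ T : Finset (Fin I.m), I.totalCost T = I.opt U ∧
    ∀ k, (I.problem k).Covers (indices T) (indices U) := by
  obtain ⟨T, hT, hopt⟩ := Finset.exists_mem_eq_inf' (I.solutions_nonempty U) I.totalCost
  refine ⟨T, hopt.symm, fun k => ⟨indices_subset T, fun u hu => ?_⟩⟩
  obtain ⟨v, hv, rfl⟩ := Finset.mem_map.1 hu
  simp only [solutions, Finset.mem_filter, Finset.mem_univ, true_and] at hT
  obtain ⟨i, hi, hmem⟩ := hT v hv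
  exact ⟨i, mem_indices.2 hi, (incidence_ne_zero v.2).2 ⟨i.2, hmem⟩⟩

/-- Binary lengths are a computable substitute for logarithms. The summand for `m` is needed in the
potential argument, the one for `k` in the rounding. -/
theorem log_m_le (k : ℕ) : Real.log (I.problem k).m ≤ (I.problem k).L := by
  refine (log_le_natSize _).trans ?_
  exact_mod_cast Nat.le_add_right _ _

theorem log_k_le (k : ℕ) : Real.log (I.problem k).k ≤ (I.problem k).L := by
  refine (log_le_natSize _).trans ?_
  exact_mod_cast Nat.le_add_left _ _

/-- The random bits as natural numbers. -/
def bits {r : ℕ} (ω : Fin r → Bool) (j : ℕ) : ℕ := if h : j < r then (ω ⟨j, h⟩).toNat else 0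

/-- The set that the algorithm assigns to `u`. -/
noncomputable def assignment (I : SetSystem) (W : Finset (Fin I.N)) {r : ℕ} (ω : Fin r → Bool)
    (u : ℕ) : ℕ :=
  (I.problem W.card).assign ((I.problem W.card).final (indices W)) (block I.m (bits ω)) u

end SetSystem

open SetSystem

/-- The universal algorithm: it learns a fractional cover from the sample and rounds it. -/
noncomputable def universalAlgorithm : UniversalAlgorithm where
  coins := Polynomial.X ^ 2
  map I W ω u := ⟨I.assignment W ω u, ((valid_problem W.card).assign_spec _ _ u.2).1⟩
  mem_map _ W _ u :=
    ((incidence_ne_zero u.2).1 ((valid_problem W.card).assign_spec _ _ u.2).2).2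

/-! ### The competitive ratio -/

namespace SetSystem

variable {I : SetSystem}

/-- All samples have `k` elements, so one covering problem serves for all of them. -/
theorem expectedCost_eq (U : Finset (Fin I.N)) (k : ℕ) :
    universalAlgorithm.expectedCost I U k =
      (𝔼 W ∈ U.powersetCard k, 𝔼 ρ : Fin I.m → Fin (2 ^ I.m),
        ((I.problem k).price ((indices U).image ((I.problem k).assign
          ((I.problem k).final (indices W)) fun i => if h : i < I.m then ρ ⟨i, h⟩ else 0)) : ℝ)) /
        I.commonDen := by
  unfold UniversalAlgorithm.expectedCost
  rw [Finset.expect_div]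
  refine Finset.expect_congr rfl fun W hW => ?_
  have hk : W.card = k := (Finset.mem_powersetCard.1 hW).2
  rw [Finset.expect_div]
  have hr : I.m * I.m ≤ (Polynomial.X ^ 2 : Polynomial ℕ).eval I.size := by
    have : I.m ≤ I.size := by unfold SetSystem.size; omega
    simpa [sq] using Nat.mul_le_mul this this
  rw [← expect_block hr (fun z => ((I.problem k).price ((indices U).image ((I.problem k).assign
    ((I.problem k).final (indices W)) z)) : ℝ) / I.commonDen)]
  · refine Finset.expect_congr rfl fun ω _ => ?_
    rw [totalCost_eq k]
    congr 3
    ext i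
    simp only [indices, Finset.mem_map, Finset.mem_image, exists_exists_and_eq_and]
    simp only [universalAlgorithm, Fin.valEmbedding_apply, assignment, hk]
    rfl
  · intro z z' hz
    congr 3
    exact Finset.image_congr fun u _ => Problem.assign_congr _ hz u

theorem inv_final_of_subset (k : ℕ) {U W : Finset (Fin I.N)} {T : Finset ℕ} (hW : W ⊆ U)
    (hT : (I.problem k).Covers T (indices U)) :
    (I.problem k).Inv T ((I.problem k).final (indices W)) :=
  Problem.inv_final (valid_problem k) (indices_subset W)
    (hT.mono (Finset.map_subset_map.2 hW)) (log_m_le k)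

theorem κ_le_price {P : Problem} (hP : P.Valid) {T U : Finset ℕ} (hU : U ⊆ Finset.range P.N)
    (hT : P.Covers T U) {u : ℕ} (hu : u ∈ U) : P.κ u ≤ P.price T := by
  obtain ⟨i, hi, ha⟩ := hT.exists_mem u hu
  exact ((hP.cheapest_spec (Finset.mem_range.1 (hU hu))).2.2 i
    (Finset.mem_range.1 (hT.subset hi)) ha).trans
    (Finset.single_le_sum (f := P.c) (fun _ _ => Nat.zero_le _) hi)

/-- The empty collection covers the empty sample at price 0, so the guess stays 0, no set is chosen
at random, and every element gets its cheapest set. -/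
theorem price_le_of_empty {U : Finset (Fin I.N)} {T : Finset ℕ}
    (hT : (I.problem 0).Covers T (indices U)) (z : ℕ → ℕ) :
    (I.problem 0).price ((indices U).image ((I.problem 0).assign ((I.problem 0).final ∅) z)) ≤
      U.card * (I.problem 0).price T := by
  have hcov : (I.problem 0).Covers ∅ ∅ := ⟨by simp, by simp⟩
  have hβ : ((I.problem 0).final ∅).β = 0 := by
    have := (Problem.inv_final (valid_problem 0) (Finset.empty_subset _) hcov (log_m_le 0)).guess
    simpa [Problem.price] using this
  refine (Problem.price_image_assign_le _ _ _).trans ?_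
  simp only [Problem.chosen, hβ, mul_zero, zero_mul, not_lt_zero, if_false, Finset.sum_const_zero,
    zero_add, Nat.sub_zero, Finset.prod_const_one, mul_one]
  have := Finset.sum_le_card_nsmul (indices U) (I.problem 0).κ ((I.problem 0).price T) fun u hu =>
    κ_le_price (valid_problem 0) (indices_subset U) hT hu
  simpa [indices] using this

theorem expect_price_le {U : Finset (Fin I.N)} {T : Finset ℕ} {k : ℕ} (hk : 0 < k)
    (hkU : k ≤ U.card) (hT : (I.problem k).Covers T (indices U)) :
    𝔼 W ∈ U.powersetCard k, 𝔼 ρ : Fin I.m → Fin (2 ^ I.m),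
        ((I.problem k).price ((indices U).image ((I.problem k).assign
          ((I.problem k).final (indices W)) fun i => if h : i < I.m then ρ ⟨i, h⟩ else 0)) : ℝ) ≤
      ((16 * (I.problem k).L + 2) + 3 * (U.card / k) +
        U.card / (k + 1) * (32 * (I.problem k).L + 6)) * (I.problem k).price T := by
  have hk' : (0 : ℝ) < k := by exact_mod_cast hk
  set P := I.problem k with hPdef
  have hP : P.Valid := valid_problem k
  set C : ℝ := (P.price T : ℝ) with hC
  set f : Finset (Fin I.N) → Fin I.N → ℝ := fun W u =>
    if P.bad (P.final (indices W)) u ≠ 0 then (P.κ u : ℝ) else 0 with hf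
  have h1 : ∀ W ∈ U.powersetCard k, 𝔼 ρ : Fin I.m → Fin (2 ^ I.m),
        (P.price ((indices U).image (P.assign
          (P.final (indices W)) fun i => if h : i < I.m then ρ ⟨i, h⟩ else 0)) : ℝ) ≤
      ((16 * P.L + 2) + 3 * (U.card / k)) * C + ∑ u ∈ U \ W, f W u := by
    intro W hW
    have hWU := (Finset.mem_powersetCard.1 hW).1
    have hinv : P.Inv T (P.final (indices W)) := inv_final_of_subset k hWU hT
    have hβ : ((P.final (indices W)).β : ℝ) ≤ 2 * C := by
      rw [hC]; exact_mod_cast hinv.guess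
    have h2 := Problem.expect_price_assign_le hP hinv.heavy (indices_subset U) hk (log_k_le k)
    refine h2.trans ?_
    rw [Finset.sum_add_distrib, Finset.sum_add_distrib, Finset.sum_const, nsmul_eq_mul,
      ← Finset.sum_div]
    -- At the end no sampled element is bad.
    have h3 : ∑ u ∈ indices U, (if P.bad (P.final (indices W)) u ≠ 0 then (P.κ u : ℝ) else 0) =
        ∑ u ∈ U \ W, f W u := by
      rw [indices, Finset.sum_map]
      refine (Finset.sum_subset Finset.sdiff_subset fun u hu hu' => ?_).symm
      have huW : u ∈ W := by
        by_contra h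
        exact hu' (Finset.mem_sdiff.2 ⟨hu, h⟩)
      rw [if_neg]
      exact not_not.2 (Problem.bad_final hP (indices_subset W) (log_m_le k) (mem_indices.2 huW))
    have h4 : ∑ u ∈ indices U, (P.κ u : ℝ) ≤ U.card * C := by
      have := Finset.sum_le_card_nsmul (indices U) (fun u => (P.κ u : ℝ)) C fun u hu => by
        rw [hC]; exact_mod_cast κ_le_price hP (indices_subset U) hT hu
      simpa [indices] using this
    have h5 : ((indices U).card : ℝ) = U.card := by simp [indices]
    have h6 : (∑ u ∈ indices U, (P.κ u : ℝ)) / (P.k : ℝ) ≤ U.card * C / k :=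
      div_le_div_of_nonneg_right h4 hk'.le
    have h7 : ((P.final (indices W)).β : ℝ) / (P.k : ℝ) ≤ 2 * C / k :=
      div_le_div_of_nonneg_right hβ hk'.le
    have h8 := mul_le_mul_of_nonneg_left h7 (Nat.cast_nonneg (α := ℝ) U.card)
    have h9 := mul_le_mul_of_nonneg_left hβ (show (0 : ℝ) ≤ 8 * P.L + 1 by positivity)
    have e1 : (U.card : ℝ) * (2 * C / k) = 2 * (U.card / k * C) := by ring
    have e2 : (U.card : ℝ) * C / k = U.card / k * C := by ring
    rw [h3, h5]
    linarith
  have hne : (U.powersetCard k).Nonempty := Finset.powersetCard_nonempty.2 hkU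
  refine (Finset.expect_le_expect h1).trans ?_
  rw [Finset.expect_add_distrib, Finset.expect_const hne]
  -- `V` has `k + 1` elements while the problem keeps the parameter `k`. The bounds for a run do not
  -- link this parameter to the size of the sample.
  have h2 := expect_sum_sdiff_le U k hkU f (B := (32 * P.L + 6) * C) (fun V hV => by
    have hVU := (Finset.mem_powersetCard.1 hV).1
    have h3 := Problem.sum_bad_erase_le hP (indices_subset V)
      (hT.mono (Finset.map_subset_map.2 hVU)) (log_m_le k)
    have h4 : ((∑ v ∈ indices V with P.bad (P.final ((indices V).erase v)) v ≠ 0, P.κ v : ℕ) : ℝ) ≤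
        (32 * P.L + 6) * C := by rw [hC]; exact_mod_cast h3
    refine le_trans (le_of_eq ?_) h4
    rw [Finset.sum_filter, indices, Finset.sum_map, Nat.cast_sum]
    refine Finset.sum_congr rfl fun v _ => ?_
    simp only [hf, indices, Finset.map_erase, Fin.valEmbedding_apply]
    split_ifs <;> simp)
  have h3 : ((U.card : ℝ) - k) / (k + 1) * ((32 * P.L + 6) * C) ≤
      U.card / (k + 1) * ((32 * P.L + 6) * C) := by
    refine mul_le_mul_of_nonneg_right ?_ (by positivity)
    gcongr
    linarith
  linarith

end SetSystem

theorem competitive_universalAlgorithm {α : ℝ} (hα : 0 < α) (hα1 : α ≤ 1) :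
    universalAlgorithm.Competitive α
      (fun m n => 200 * max 1 (Real.log ((m : ℝ) * (n : ℝ))) / α) := by
  intro I U k hk
  obtain ⟨T, hT, hcov⟩ := exists_opt U
  have hD : (0 : ℝ) < I.commonDen := by exact_mod_cast I.commonDen_pos
  have hαn : α * U.card ≤ k + 1 := by
    rcases hk with rfl | rfl
    · exact (Nat.lt_floor_add_one _).le
    · exact (Nat.le_ceil _).trans (by linarith)
  have hαle : α * U.card ≤ U.card := mul_le_of_le_one_left (Nat.cast_nonneg _) hα1
  have hkU : k ≤ U.card := by
    rcases hk with rfl | rfl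
    · exact Nat.floor_le_of_le hαle
    · exact Nat.ceil_le.2 hαle
  set Λ := max 1 (Real.log ((I.m : ℝ) * (U.card : ℝ))) with hΛ
  have hΛ1 : 1 ≤ Λ := le_max_left _ _
  rw [expectedCost_eq, div_le_iff₀ hD, ← hT, totalCost_eq k]
  set C : ℝ := ((I.problem k).price (indices T) : ℝ) with hC
  have hC0 : 0 ≤ C := Nat.cast_nonneg _
  have e1 : 200 * Λ / α * (C / I.commonDen) * I.commonDen = 200 * Λ / α * C := by field_simp
  rw [e1]
  rcases Nat.eq_zero_or_pos k with rfl | hk0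
  · have h1 : (U.card : ℝ) ≤ 1 / α := by
      rw [le_div_iff₀ hα]
      simpa [mul_comm] using hαn
    have h2 : (U.card : ℝ) * C ≤ 200 * Λ / α * C := by
      refine mul_le_mul_of_nonneg_right (h1.trans ?_) hC0
      gcongr
      linarith
    refine le_trans ?_ h2
    rw [Finset.powersetCard_zero, Finset.expect_singleton]
    refine Finset.expect_le (Finset.univ_nonempty) fun ρ _ => ?_
    rw [show indices (∅ : Finset (Fin I.N)) = ∅ from Finset.map_empty _]
    rw [hC]
    exact_mod_cast price_le_of_empty (hcov 0) fun i => if h : i < I.m then (ρ ⟨i, h⟩ : ℕ) else 0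
  · refine (expect_price_le hk0 hkU (hcov k)).trans (mul_le_mul_of_nonneg_right ?_ hC0)
    have hk' : (1 : ℝ) ≤ k := by exact_mod_cast hk0
    have hm : 0 < I.m := by
      obtain ⟨u, -⟩ : U.Nonempty := Finset.card_pos.1 (by omega)
      obtain ⟨i, -⟩ := I.covers u
      exact i.pos
    -- The two binary lengths sum to at most `2 + 3/2 * (log m + log k)`, and both 1 and `log m +
    -- log n` are at most `Λ`.
    have hL : ((I.problem k).L : ℝ) ≤ 7 / 2 * Λ := by
      have h1 := natSize_le_log hm
      have h2 := natSize_le_log hk0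
      have h3 : Real.log k ≤ Real.log U.card :=
        Real.log_le_log (by linarith) (by exact_mod_cast hkU)
      have hn : (U.card : ℝ) ≠ 0 := by
        have : 0 < U.card := by omega
        exact_mod_cast this.ne'
      have h4 : Real.log ((I.m : ℝ) * (U.card : ℝ)) = Real.log I.m + Real.log U.card :=
        Real.log_mul (by exact_mod_cast hm.ne') hn
      have h5 : Real.log I.m + Real.log U.card ≤ Λ := by
        rw [← h4]; exact le_max_right _ _
      change ((Nat.size I.m + Nat.size k : ℕ) : ℝ) ≤ _
      push_cast
      linarith
    have h1 : (U.card : ℝ) / (k + 1) ≤ 1 / α := by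
      rw [div_le_div_iff₀ (by linarith) hα]
      linarith
    -- `α * n ≤ k + 1 ≤ 2 * k`, as `k` is positive in this case.
    have h2 : (U.card : ℝ) / k ≤ 2 / α := by
      rw [div_le_div_iff₀ (by linarith) hα]
      linarith
    have h3 : 1 ≤ 1 / α := by
      rw [le_div_iff₀ hα]; linarith
    set L : ℝ := ((I.problem k).L : ℝ)
    have hL0 : 0 ≤ L := Nat.cast_nonneg _
    calc 16 * L + 2 + 3 * (U.card / k) + U.card / (k + 1) * (32 * L + 6)
        ≤ (16 * L + 2) * (1 / α) + 3 * (2 / α) + 1 / α * (32 * L + 6) := by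
          have := mul_le_mul_of_nonneg_left h3 (show 0 ≤ 16 * L + 2 by positivity)
          have := mul_le_mul_of_nonneg_right h1 (show 0 ≤ 32 * L + 6 by positivity)
          linarith
      _ = (48 * L + 14) * (1 / α) := by ring
      -- `48 * 7/2 + 14 = 182`.
      _ ≤ (200 * Λ) * (1 / α) := by
          refine mul_le_mul_of_nonneg_right ?_ (by positivity)
          linarith
      _ = 200 * Λ / α := by ring

end SetCover

namespace SetCover

/-! ### Terms for the algorithm -/

namespace Term

instance : Add Term := ⟨bin .add⟩
instance : Sub Term := ⟨bin .sub⟩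
instance : Mul Term := ⟨bin .mul⟩
instance : Div Term := ⟨bin .div⟩

def less (e₁ e₂ : Term) : Term := bin .lt e₁ e₂

/-- `1 - e` -/
def compl (e : Term) : Term := bin .sub (lit 1) e

/-- The first index below a dimension for which `e` is not zero. In `e`, bound variable `0` is the
index, and bound variable `1` is not to be used. -/
def first (n : Fin 2) (e : Term) : Term :=
  sum n (prod n (compl (compl (less (var 1) (var 0)) * e)))

/-- `2 ^ j`, where `j` is bound variable `0` and at most the dimension. -/
def twoPow (n : Fin 2) : Term := prod n (lit 1 + less (var 0) (var 1))

/-- The binary length of `e`, if it is at most the dimension. The term `e` must not use bound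
variables. -/
def length (n : Fin 2) (e : Term) : Term := sum n (compl (less e (twoPow n)))

/-- Entry `(i, u)` of the incidence matrix. -/
def incident (i u : Term) : Term := get 0 (i * dim 0 + u)

variable (σ : State) (ρ : List ℕ) (e e₁ e₂ : Term)

theorem eval_add : (e₁ + e₂).eval σ ρ = e₁.eval σ ρ + e₂.eval σ ρ := rfl
theorem eval_mul : (e₁ * e₂).eval σ ρ = e₁.eval σ ρ * e₂.eval σ ρ := rfl
theorem eval_less : (less e₁ e₂).eval σ ρ = if e₁.eval σ ρ < e₂.eval σ ρ then 1 else 0 := rfl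
theorem eval_compl : (compl e).eval σ ρ = 1 - e.eval σ ρ := rfl
theorem eval_lit (n : ℕ) : (lit n).eval σ ρ = n := rfl
theorem eval_sum (n : Fin 2) :
    (sum n e).eval σ ρ = ∑ j ∈ Finset.range (σ.reg n), e.eval σ (j :: ρ) := rfl
theorem eval_prod (n : Fin 2) :
    (prod n e).eval σ ρ = ∏ j ∈ Finset.range (σ.reg n), e.eval σ (j :: ρ) := rfl

variable {σ ρ e}

/-- The term sits under two binders; quantifying over `j` says that it ignores the outer index. -/
theorem eval_first {n : Fin 2} {b : ℕ → ℕ}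
    (h : ∀ i < σ.reg n, ∀ j, e.eval σ (i :: j :: ρ) = b i) :
    (first n e).eval σ ρ = firstIdx (σ.reg n) b := by
  refine Finset.sum_congr rfl fun j _ => Finset.prod_congr rfl fun i hi => ?_
  rw [eval_compl, eval_mul, eval_compl, eval_less, h i (Finset.mem_range.1 hi)]
  rfl

theorem eval_twoPow {n : Fin 2} {j : ℕ} (hj : j ≤ σ.reg n) :
    (twoPow n).eval σ (j :: ρ) = 2 ^ j := by
  rw [twoPow, eval_prod]
  have h1 : ∀ i ∈ Finset.range (σ.reg n), (lit 1 + less (var 0) (var 1)).eval σ (i :: j :: ρ) =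
      if i < j then 2 else 1 := fun i _ => by
    rw [eval_add, eval_less, eval_lit]
    change 1 + (if i < j then 1 else 0) = _
    split_ifs <;> rfl
  have h2 : (Finset.range (σ.reg n)).filter (· < j) = Finset.range j := by
    ext i; simp; omega
  rw [Finset.prod_congr rfl h1, ← Finset.prod_filter, h2, Finset.prod_const, Finset.card_range]

/-- The term counts the exponents `j` with `2 ^ j ≤ x`, which are those below the binary length. -/
theorem eval_length {n : Fin 2} {x : ℕ} (hx : ∀ ρ, e.eval σ ρ = x) (hn : Nat.size x ≤ σ.reg n) :
    (length n e).eval σ ρ = Nat.size x := by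
  rw [length, eval_sum]
  have h1 : ∀ j ∈ Finset.range (σ.reg n), (compl (less e (twoPow n))).eval σ (j :: ρ) =
      if j < Nat.size x then 1 else 0 := fun j hj => by
    rw [eval_compl, eval_less, hx, eval_twoPow (Finset.mem_range.1 hj).le]
    have : x < 2 ^ j ↔ ¬j < Nat.size x := by rw [Nat.lt_size, not_le]
    simp only [this]
    split_ifs <;> simp_all
  have h2 : (Finset.range (σ.reg n)).filter (· < Nat.size x) = Finset.range (Nat.size x) := by
    ext i; simp; omega
  rw [Finset.sum_congr rfl h1, ← Finset.sum_filter, h2]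
  simp

end Term

/-! ### Memory as lists -/

/-- The state with the listed registers and arrays, and zeros everywhere else. -/
def State.ofLists (l : List ℕ) (A : List (ℕ → ℕ)) : State :=
  ⟨fun r => l.getD r 0, fun a => A.getD a fun _ => 0⟩

/-- The function `f`, cut off at `n`. -/
def below (n : ℕ) (f : ℕ → ℕ) (j : ℕ) : ℕ := if j < n then f j else 0

theorem below_of_lt {n j : ℕ} {f : ℕ → ℕ} (h : j < n) : below n f j = f j := if_pos h

theorem below_of_le {n j : ℕ} {f : ℕ → ℕ} (h : n ≤ j) : below n f j = 0 := if_neg (not_lt.2 h)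

namespace Cmd

theorem den_seq (c₁ c₂ : Cmd) (σ : State) : (seq c₁ c₂).den σ = c₂.den (c₁.den σ) := rfl

theorem den_set {l l' : List ℕ} {A : List (ℕ → ℕ)} {y : Fin 14} {e : Term} {v : ℕ}
    (hv : e.eval (.ofLists l A) [] = v) (hy : (y : ℕ) + 2 < l.length)
    (hl : l.set (y + 2) v = l') : (set y e).den (.ofLists l A) = .ofLists l' A := by
  subst hl hv
  simp only [den, State.setReg, State.ofLists, State.mk.injEq, and_true]
  funext r
  simp only [Function.update_apply, List.getD_eq_getElem?_getD, List.getElem?_set]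
  by_cases hr : r = y + 2
  · subst hr; simp [hy]
  · simp [hr, Ne.symm hr]

/-- The command leaves the entries from `N` on alone, so `hz` is needed for the result to be the
cut-off function. -/
theorem den_map {l : List ℕ} {A A' : List (ℕ → ℕ)} {a N : ℕ} {n : Fin 2} {e : Term} {f : ℕ → ℕ}
    (hf : ∀ j < N, e.eval (.ofLists l A) [j] = f j) (hN : l.getD n 0 = N) (ha : a < A.length)
    (hz : ∀ j, N ≤ j → A.getD a (fun _ => 0) j = 0) (hA : A.set a (below N f) = A') :
    (map a n e).den (.ofLists l A) = .ofLists l A' := by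
  subst hA hN
  simp only [den, State.ofLists, State.mk.injEq, true_and]
  funext a' j
  simp only [Function.update_apply, List.getD_eq_getElem?_getD, List.getElem?_set]
  by_cases hr : a' = a
  · subst hr
    simp only [ha, if_true, Option.getD_some, below]
    split_ifs with hj
    · exact hf j (by simpa [List.getD_eq_getElem?_getD] using hj)
    · exact hz j (by simpa [List.getD_eq_getElem?_getD] using hj)
  · simp [hr, Ne.symm hr]

end Cmd

theorem bounded_ofLists {l : List ℕ} {A : List (ℕ → ℕ)} {b : ℕ}
    (h0 : ∀ n : Fin 2, l.getD n 0 ≤ b) (hl : ∀ x ∈ l, Nat.size x ≤ b)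
    (hA : ∀ f ∈ A, ∀ j, Nat.size (f j) ≤ b) : Bounded b (.ofLists l A) := by
  refine ⟨h0, fun r _ => ?_, fun a j => ?_⟩
  · simp only [State.ofLists, List.getD_eq_getElem?_getD]
    rcases hx : l[r]? with _ | x
    · simp
    · exact hl x (List.mem_of_getElem? hx)
  · simp only [State.ofLists, List.getD_eq_getElem?_getD]
    rcases hx : A[a]? with _ | f
    · simp
    · exact hA f (List.mem_of_getElem? hx) j

/-! ### The program

Variables: `0` sample size, `1` the parameter `L`, `2` common denominator, `3` guess, `4` cost of
mistakes, `5` selected element, `6` total weight, `7` to `9` temporary. Arrays from `6` on: scaled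
costs, cheapest sets, their costs, weights, new weights, chosen sets, hitting sets. -/

namespace Cmd

open Term

/-- Compute the total weight and select a bad element of the sample. -/
def scan : Cmd :=
  .seq (.set 6 (sum 1 (get 9 (var 0)))) <|
  .set 5 (first 0 (get 3 (var 0) * (less (reg 3) (get 8 (var 0) * reg 0) *
    compl (less (reg 6) (lit 8 *
      sum 1 (incident (var 0) (var 1) * (reg 3 * get 9 (var 0) / get 6 (var 0))))))))

def preparation : Cmd :=
  .seq (.set 0 (sum 0 (get 3 (var 0)))) <|
  .seq (.set 1 (length 1 (dim 1) + length 0 (reg 0))) <|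
  .seq (.set 2 (prod 1 (get 2 (var 0)))) <|
  .seq (.map 6 1 (get 1 (var 0) * (reg 2 / get 2 (var 0)))) <|
  .seq (.map 7 0 (first 1 (incident (var 0) (var 2) *
    compl (sum 1 (incident (var 0) (var 3) * less (get 6 (var 0)) (get 6 (var 1))))))) <|
  .seq (.map 8 0 (get 6 (get 7 (var 0)))) scan

/-- One step of the multiplicative weights method. -/
def iteration : Cmd :=
  .seq (.set 8 (get 8 (reg 5))) <|
  .seq (.set 7 (compl (compl (less (reg 3) (reg 8)) *
    compl (less (lit 8 * reg 3 * reg 1) (reg 4))))) <|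
  .seq (.set 9 (lit 2 * (reg 3 + (reg 8 - reg 3)))) <|
  .seq (.map 10 1 (reg 7 * (compl (less (reg 9) (get 6 (var 0))) * reg 0) + compl (reg 7) *
    (get 9 (var 0) + incident (var 0) (reg 5) * (get 9 (var 0) * reg 8 / get 6 (var 0))))) <|
  .seq (.set 4 (compl (reg 7) * (reg 4 + reg 8))) <|
  .seq (.set 3 (reg 7 * reg 9 + compl (reg 7) * reg 3)) <|
  .seq (.map 9 1 (get 10 (var 0))) <|
  .seq (.set 7 (lit 0)) <| .seq (.set 8 (lit 0)) <| .seq (.set 9 (lit 0)) scan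

/-- Choose sets at random and assign sets to the elements. -/
def rounding : Cmd :=
  .seq (.map 11 1 (less
    (sum 1 (get 4 (var 1 * dim 1 + var 0) * twoPow 1) * reg 6 * get 6 (var 0))
    (lit 8 * reg 1 * reg 3 * get 9 (var 0) * prod 1 (lit 2)))) <|
  .seq (.map 12 0 (first 1 (incident (var 0) (var 2) * get 11 (var 0)))) <|
  .map 5 0 (less (get 12 (var 0)) (dim 1) * get 12 (var 0) +
    compl (less (get 12 (var 0)) (dim 1)) * get 7 (var 0))

theorem wellFormed_scan : scan.WellFormed := ⟨trivial, trivial⟩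

theorem wellFormed_preparation : preparation.WellFormed := by
  simp [preparation, WellFormed, wellFormed_scan, Avoids, first, Term.compl, less, incident,
    HMul.hMul, Mul.mul, HDiv.hDiv, Div.div, HAdd.hAdd, Add.add]

theorem wellFormed_iteration : iteration.WellFormed := by
  simp [iteration, WellFormed, wellFormed_scan, Avoids, Term.compl, less, incident,
    HMul.hMul, Mul.mul, HDiv.hDiv, Div.div, HAdd.hAdd, Add.add]

theorem wellFormed_rounding : rounding.WellFormed := by
  simp [rounding, WellFormed, Avoids, first, twoPow, Term.compl, less, incident,
    HMul.hMul, Mul.mul, HAdd.hAdd, Add.add]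

end Cmd

namespace SetSystem

variable (I : SetSystem) (W : Finset (Fin I.N)) {r : ℕ} (ω : Fin r → Bool)

/-- The indicator function of a set of elements. -/
def mark {n : ℕ} (W : Finset (Fin n)) (j : ℕ) : ℕ := if j ∈ indices W then 1 else 0

theorem input_eq : I.input W ω = .ofLists [I.N, I.m, 0, 0, 0, 0, 0, 0, 0, 0, 0, 0]
    [I.incidence, I.num, I.den, mark W, bits ω, fun _ => 0, fun _ => 0, fun _ => 0, fun _ => 0,
      fun _ => 0, fun _ => 0, fun _ => 0, fun _ => 0] := by
  simp only [input, State.ofLists, State.mk.injEq]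
  constructor
  · funext x
    rcases x with _ | _ | _ | _ | _ | _ | _ | _ | _ | _ | _ | _ | x <;> rfl
  · funext a j
    rcases a with _ | _ | _ | _ | _ | _ | _ | _ | _ | _ | _ | _ | _ | x <;> try rfl
    simp only [List.getD_cons_succ, List.getD_cons_zero, mark, indices, Finset.mem_map,
      Fin.valEmbedding_apply, eq_comm]

/-- The registers when the learner is in state `s`. -/
noncomputable def registers (v t a b c : ℕ) (s : Learner) : List ℕ :=
  [I.N, I.m, W.card, (I.problem W.card).L, I.commonDen, s.β, s.M, v, t, a, b, c]

/-- The arrays when the old and the new weights are `w` and `w'`. -/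
noncomputable def arrays (w w' f g h : ℕ → ℕ) : List (ℕ → ℕ) :=
  [I.incidence, I.num, I.den, mark W, bits ω, f, below I.m (I.problem W.card).c,
    below I.N (I.problem W.card).cheapest, below I.N (I.problem W.card).κ,
    below I.m w, below I.m w', g, h]

/-- The memory when the learner is in state `s`. -/
noncomputable def memory (s : Learner) : State :=
  .ofLists (I.registers W ((I.problem W.card).select (indices W) s) ((I.problem W.card).total s)
    0 0 0 s) (I.arrays W ω s.w s.w (fun _ => 0) (fun _ => 0) (fun _ => 0))

end SetSystem

end SetCover

/-! ### Correctness of the commands -/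

namespace SetCover

namespace SetSystem

variable (I : SetSystem) (W : Finset (Fin I.N)) {r : ℕ} (ω : Fin r → Bool)

open Term Cmd

theorem sum_range_below {n : ℕ} (f : ℕ → ℕ) :
    ∑ j ∈ Finset.range n, below n f j = ∑ j ∈ Finset.range n, f j :=
  Finset.sum_congr rfl fun _ hj => below_of_lt (Finset.mem_range.1 hj)

theorem den_scan (s : Learner) (v t : ℕ) :
    scan.den (.ofLists (I.registers W v t 0 0 0 s)
      (I.arrays W ω s.w s.w (fun _ => 0) (fun _ => 0) (fun _ => 0))) = I.memory W ω s := by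
  set P := I.problem W.card
  set A := I.arrays W ω s.w s.w (fun _ => 0) (fun _ => 0) (fun _ => 0)
  rw [scan, den_seq, den_set (v := P.total s) (l' := I.registers W v (P.total s) 0 0 0 s) ?_
    (by simp [registers]) rfl, den_set (v := P.select (indices W) s) ?_ (by simp [registers]) rfl]
  · rfl
  · refine eval_first fun u hu _ => ?_
    have hu' : u < I.N := hu
    have hload : ∀ i ∈ Finset.range I.m, P.a i u * (s.β * below I.m s.w i / below I.m P.c i) =
        P.a i u * (s.β * s.w i / P.c i) := fun i hi => by
      rw [below_of_lt (Finset.mem_range.1 hi), below_of_lt (Finset.mem_range.1 hi)]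
    rw [eval_mul, eval_mul, eval_compl, eval_less, eval_less, eval_mul _ _ (lit 8), eval_sum]
    change (if u ∈ indices W then 1 else 0) * ((if s.β < below I.N P.κ u * P.k then 1 else 0) *
      (1 - if P.total s < 8 * ∑ i ∈ Finset.range I.m,
        P.a i u * (s.β * below I.m s.w i / below I.m P.c i) then 1 else 0)) = _
    rw [below_of_lt hu', Finset.sum_congr rfl hload]
    rfl
  · exact sum_range_below s.w

theorem den_preparation : preparation.den (I.input W ω) = I.memory W ω ⟨0, 0, fun _ => 0⟩ := by
  set P := I.problem W.card with hP
  have hk : W.card ≤ I.N := by simpa using Finset.card_le_univ W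
  let z : ℕ → ℕ := fun _ => 0
  let l : ℕ → ℕ → ℕ → List ℕ := fun k L D => [I.N, I.m, k, L, D, 0, 0, 0, 0, 0, 0, 0]
  let A : (ℕ → ℕ) → (ℕ → ℕ) → (ℕ → ℕ) → List (ℕ → ℕ) := fun c ch κ =>
    [I.incidence, I.num, I.den, mark W, bits ω, z, c, ch, κ, z, z, z, z]
  have hcard : ∑ u ∈ Finset.range I.N, mark W u = W.card := by
    have h1 : (Finset.range I.N).filter (· ∈ indices W) = indices W := by
      rw [Finset.filter_mem_eq_inter, Finset.inter_eq_right.2 (indices_subset W)]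
    simp only [mark]
    rw [← Finset.sum_filter, h1]
    simp [indices]
  rw [input_eq, preparation, den_seq, den_set (v := W.card) (l' := l W.card 0 0) ?_ (by simp) rfl,
    den_seq, den_set (v := P.L) (l' := l W.card P.L 0) ?_ (by simp [l]) rfl,
    den_seq, den_set (v := I.commonDen) (l' := l W.card P.L I.commonDen) ?_ (by simp [l]) rfl,
    den_seq, den_map (f := P.c) (N := I.m) (A' := A (below I.m P.c) z z) ?_ rfl (by simp)
      (fun _ _ => rfl) rfl,
    den_seq, den_map (f := P.cheapest) (N := I.N)
      (A' := A (below I.m P.c) (below I.N P.cheapest) z) ?_ rfl (by simp [A])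
      (fun _ _ => rfl) rfl,
    den_seq, den_map (f := P.κ) (N := I.N)
      (A' := A (below I.m P.c) (below I.N P.cheapest) (below I.N P.κ)) ?_ rfl (by simp [A])
      (fun _ _ => rfl) rfl]
  · have hb : below I.m (fun _ => 0) = fun _ => 0 := by
      funext j; simp [below]
    have := I.den_scan W ω ⟨0, 0, fun _ => 0⟩ 0 0
    rw [arrays, hb] at this
    exact this
  · intro u hu
    have h : P.cheapest u < I.m := ((valid_problem W.card).cheapest_spec hu).1
    change below I.m P.c (below I.N P.cheapest u) = _
    rw [below_of_lt hu, below_of_lt h]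
    rfl
  · intro u _
    refine eval_first fun i hi j => ?_
    have hi' : i < I.m := hi
    rw [eval_mul, eval_compl, eval_sum]
    change P.a i u * (1 - ∑ i' ∈ Finset.range I.m,
      P.a i' u * if below I.m P.c i' < below I.m P.c i then 1 else 0) = _
    rw [below_of_lt hi', Finset.sum_congr rfl fun i' hi' => by
      rw [below_of_lt (Finset.mem_range.1 hi')]]
    rfl
  · intro i _
    rfl
  · rfl
  -- The two lengths are computed with different dimensions: that of `m` with `m`, that of the
  -- sample size with `N`.
  · rw [eval_add, eval_length (x := I.m) (fun _ => rfl) (size_le_self _),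
      eval_length (x := W.card) (fun _ => rfl) ((size_le_self _).trans hk)]
    rfl
  · exact hcard

/-- The restart flag `R` turns the case distinction of `Problem.update` into arithmetic. The new
weights pass through array 10, as an assignment may not read the array that it writes. Clearing the
temporaries restores the normal form `memory`. -/
theorem den_iteration (s : Learner)
    (hs : (I.problem W.card).select (indices W) s < I.N) :
    iteration.den (I.memory W ω s) =
      I.memory W ω ((I.problem W.card).step (indices W) s) := by
  set P := I.problem W.card with hP
  set u := P.select (indices W) s with hu
  set s' := P.update s u with hs'
  have hstep : P.step (indices W) s = s' := if_pos hs
  set R : ℕ := if s.β < P.κ u ∨ 8 * s.β * P.L < s.M then 1 else 0 with hR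
  set B : ℕ := 2 * (s.β + (P.κ u - s.β)) with hB
  have hβ : R * B + (1 - R) * s.β = s'.β := by
    rw [hs', Problem.update, hR]
    split_ifs <;> simp [hB]
  have hM : (1 - R) * (s.M + P.κ u) = s'.M := by
    rw [hs', Problem.update, hR]
    split_ifs <;> simp
  have hw : ∀ i, R * ((1 - if B < P.c i then 1 else 0) * P.k) +
      (1 - R) * (s.w i + P.a i u * (s.w i * P.κ u / P.c i)) = s'.w i := by
    intro i
    rw [hs', Problem.update, hR]
    by_cases h : s.β < P.κ u ∨ 8 * s.β * P.L < s.M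
    · simp only [if_pos h]
      by_cases h' : B < P.c i
      · simp [h', ← hB]
      · simp [h', ← hB]
    · simp [if_neg h]
  -- Disjunction of two indicators.
  have hRval : 1 - (1 - if s.β < P.κ u then 1 else 0) *
      (1 - if 8 * s.β * P.L < s.M then 1 else 0) = R := by
    rw [hR]
    by_cases h1 : s.β < P.κ u <;> by_cases h2 : 8 * s.β * P.L < s.M <;> simp [h1, h2]
  let z : ℕ → ℕ := fun _ => 0
  let t := P.total s
  rw [memory, iteration, den_seq, den_set (v := P.κ u) (l' := I.registers W u t 0 (P.κ u) 0 s) ?_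
      (by simp [registers]) rfl,
    den_seq, den_set (v := R) (l' := I.registers W u t R (P.κ u) 0 s) ?_
      (by simp [registers]) rfl,
    den_seq, den_set (v := B) (l' := I.registers W u t R (P.κ u) B s) ?_
      (by simp [registers]) rfl,
    den_seq, den_map (a := 10) (f := s'.w) (N := I.m) (A := I.arrays W ω s.w s.w z z z)
      (A' := I.arrays W ω s.w s'.w z z z) ?_ rfl
      (by simp [arrays]) (fun j hj => below_of_le (f := s.w) hj) rfl,
    den_seq, den_set (v := s'.M) (l' := I.registers W u t R (P.κ u) B ⟨s.β, s'.M, s.w⟩) ?_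
      (by simp [registers]) rfl,
    den_seq, den_set (v := s'.β) (l' := I.registers W u t R (P.κ u) B s') ?_
      (by simp [registers]) rfl,
    den_seq, den_map (a := 9) (f := s'.w) (N := I.m) (A := I.arrays W ω s.w s'.w z z z)
      (A' := I.arrays W ω s'.w s'.w z z z) ?_ rfl
      (by simp [arrays]) (fun j hj => below_of_le (f := s.w) hj) rfl,
    den_seq, den_set (v := 0) (l' := I.registers W u t 0 (P.κ u) B s') rfl
      (by simp [registers]) rfl,
    den_seq, den_set (v := 0) (l' := I.registers W u t 0 0 B s') rfl
      (by simp [registers]) rfl,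
    den_seq, den_set (v := 0) (l' := I.registers W u t 0 0 0 s') rfl
      (by simp [registers]) rfl, hstep]
  · exact I.den_scan W ω s' u t
  · intro j hj
    exact below_of_lt hj
  · exact hβ
  · exact hM
  · intro i hi
    rw [← hw i]
    change R * ((1 - if B < below I.m P.c i then 1 else 0) * P.k) + (1 - R) *
      (below I.m s.w i + P.a i u * (below I.m s.w i * P.κ u / below I.m P.c i)) = _
    rw [below_of_lt hi, below_of_lt hi]
  · rfl
  · exact hRval
  · exact below_of_lt hs

theorem den_rounding (s : Learner) {u : ℕ} (hu : u < I.N) :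
    (rounding.den (I.memory W ω s)).arr 5 u =
      (I.problem W.card).assign s (block I.m (bits ω)) u := by
  set P := I.problem W.card with hP
  let z : ℕ → ℕ := fun _ => 0
  let A : (ℕ → ℕ) → (ℕ → ℕ) → (ℕ → ℕ) → List (ℕ → ℕ) := fun out f g =>
    [I.incidence, I.num, I.den, mark W, bits ω, out, below I.m P.c, below I.N P.cheapest,
      below I.N P.κ, below I.m s.w, below I.m s.w, f, g]
  let f : ℕ → ℕ := fun i => P.chosen s i (block I.m (bits ω) i)
  let g : ℕ → ℕ := P.hitter s (block I.m (bits ω))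
  have hout : ∀ u < I.N, (if g u < I.m then 1 else 0) * g u +
      (1 - if g u < I.m then 1 else 0) * P.cheapest u = P.assign s (block I.m (bits ω)) u := by
    intro u _
    unfold Problem.assign
    change _ = if g u < I.m then g u else P.cheapest u
    split_ifs <;> simp
  rw [memory, rounding, den_seq, den_map (f := f) (N := I.m) (A' := A z (below I.m f) z) ?_ rfl
      (by simp [arrays]) (fun _ _ => rfl) rfl,
    den_seq, den_map (f := g) (N := I.N) (A' := A z (below I.m f) (below I.N g)) ?_ rfl
      (by simp [A]) (fun _ _ => rfl) rfl,
    den_map (f := P.assign s (block I.m (bits ω))) (N := I.N)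
      (A' := A (below I.N (P.assign s (block I.m (bits ω)))) (below I.m f) (below I.N g)) ?_ rfl
      (by simp [A]) (fun _ _ => rfl) rfl]
  · exact below_of_lt hu
  · intro u hu
    rw [← hout u hu]
    change (if below I.N g u < I.m then 1 else 0) * below I.N g u +
      (1 - if below I.N g u < I.m then 1 else 0) * below I.N P.cheapest u = _
    rw [below_of_lt hu, below_of_lt hu]
  · intro u _
    refine eval_first fun i hi j => ?_
    have hi' : i < I.m := hi
    change P.a i u * below I.m f i = _
    rw [below_of_lt hi']
  · intro i hi
    rw [eval_less, eval_mul, eval_mul, eval_sum, eval_mul _ _ _ (prod 1 (lit 2)), eval_prod]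
    have h1 : ∀ j ∈ Finset.range I.m, (get 4 (var 1 * dim 1 + var 0) * twoPow 1).eval
        (.ofLists (I.registers W (P.select (indices W) s) (P.total s) 0 0 0 s)
          (I.arrays W ω s.w s.w (fun _ => 0) (fun _ => 0) (fun _ => 0))) [j, i] =
        bits ω (i * I.m + j) * 2 ^ j := fun j hj => by
      rw [eval_mul, eval_twoPow (Finset.mem_range.1 hj).le]
      rfl
    change (if (∑ j ∈ Finset.range I.m, (get 4 (var 1 * dim 1 + var 0) * twoPow 1).eval _ [j, i]) *
      P.total s * below I.m P.c i < 8 * P.L * s.β * below I.m s.w i *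
        ∏ j ∈ Finset.range I.m, 2 then 1 else 0) = _
    rw [Finset.sum_congr rfl h1, below_of_lt hi, below_of_lt hi, Finset.prod_const,
      Finset.card_range]
    rfl

end SetSystem

end SetCover

namespace SetCover

namespace SetSystem

variable {I : SetSystem}

/-! ### Sizes of the numbers that occur -/

theorem m_le_size : I.m ≤ I.size := by unfold size; omega

theorem N_le_size : I.N ≤ I.size := by unfold size; omega

theorem size_cost_le (i : Fin I.m) :
    Nat.size (I.cost i).num + Nat.size (I.cost i).den ≤ I.size := by
  have := Finset.single_le_sum (s := Finset.univ)
    (f := fun i => Nat.size (I.cost i).num + Nat.size (I.cost i).den)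
    (fun _ _ => Nat.zero_le _) (Finset.mem_univ i)
  unfold size
  omega

theorem size_num_le (j : ℕ) : Nat.size (I.num j) ≤ I.size := by
  unfold num
  split_ifs with h
  · have := size_cost_le ⟨j, h⟩
    omega
  · simp

theorem size_den_le (j : ℕ) : Nat.size (I.den j) ≤ I.size := by
  unfold den
  split_ifs with h
  · have := size_cost_le ⟨j, h⟩
    omega
  · simp

theorem size_commonDen_le : Nat.size I.commonDen ≤ I.size * I.size + 1 :=
  size_prod_le m_le_size fun j _ => size_den_le j

theorem size_c_le (k j : ℕ) :
    Nat.size ((I.problem k).c j) ≤ I.size + (I.size * I.size + 1) := by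
  refine (size_mul_le _ _).trans (add_le_add (size_num_le j) ?_)
  exact (Nat.size_le_size (Nat.div_le_self _ _)).trans size_commonDen_le

theorem size_two_mul_price_le (k : ℕ) :
    Nat.size (2 * (I.problem k).price (Finset.range (I.problem k).m)) ≤
      I.size * I.size + 2 * I.size + 3 := by
  have h1 := size_mul_le 2 ((I.problem k).price (Finset.range (I.problem k).m))
  have h2 := size_sum_le (f := (I.problem k).c) (m_le_size (I := I)) fun j _ => size_c_le k j
  have h3 : Nat.size 2 = 2 := by rfl
  change Nat.size ((I.problem k).price (Finset.range (I.problem k).m)) ≤ _ at h2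
  omega

theorem L_le (k : ℕ) (hk : k ≤ I.N) : (I.problem k).L ≤ 2 * I.size := by
  have h1 := size_le_self I.m
  have h2 := size_le_self k
  have h3 := m_le_size (I := I)
  have h4 := N_le_size (I := I)
  change Nat.size I.m + Nat.size k ≤ _
  omega

open _root_.Polynomial in
/-- A bound for the number of iterations. -/
noncomputable def fuelBound : ℕ[X] := (X * (16 * X + 1) + 1) * (1 + (X * X + 2 * X + 3))

open _root_.Polynomial in
/-- A bound for the binary length of the numbers that occur. -/
noncomputable def sizeBound : ℕ[X] := fuelBound + X * X + 20 * X + 10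

theorem fuel_le (k : ℕ) (hk : k ≤ I.N) : (I.problem k).fuel ≤ fuelBound.eval I.size := by
  have h : fuelBound.eval I.size = (I.size * (16 * I.size + 1) + 1) *
      (1 + (I.size * I.size + 2 * I.size + 3)) := by simp [fuelBound]
  rw [h]
  refine Nat.mul_le_mul (Nat.add_le_add_right (Nat.mul_le_mul (hk.trans N_le_size) ?_) _)
    (Nat.add_le_add_left (size_two_mul_price_le k) _)
  have := L_le k hk
  omega

theorem eval_sizeBound (x : ℕ) :
    sizeBound.eval x = fuelBound.eval x + x * x + 20 * x + 10 := by
  simp [sizeBound]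

theorem size_below_le {n b : ℕ} {f : ℕ → ℕ} (h : ∀ j < n, Nat.size (f j) ≤ b) (j : ℕ) :
    Nat.size (below n f j) ≤ b := by
  unfold below
  split_ifs with hj
  · exact h j hj
  · simp

theorem size_le_of_le_one {x b : ℕ} (hx : x ≤ 1) (hb : 1 ≤ b) : Nat.size x ≤ b :=
  (size_le_self x).trans (hx.trans hb)

theorem size_incidence_le {b : ℕ} (hb : 1 ≤ b) (j : ℕ) : Nat.size (I.incidence j) ≤ b :=
  size_le_of_le_one (by unfold incidence; split_ifs <;> simp) hb

theorem size_mark_le {n b : ℕ} (W : Finset (Fin n)) (hb : 1 ≤ b) (j : ℕ) :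
    Nat.size (mark W j) ≤ b :=
  size_le_of_le_one (by unfold mark; split_ifs <;> simp) hb

theorem size_bits_le {r b : ℕ} (ω : Fin r → Bool) (hb : 1 ≤ b) (j : ℕ) :
    Nat.size (bits ω j) ≤ b :=
  size_le_of_le_one (by unfold bits; split_ifs <;> simp [Bool.toNat_le]) hb

theorem bounded_input (W : Finset (Fin I.N)) {r : ℕ} (ω : Fin r → Bool) :
    Bounded (sizeBound.eval I.size) (I.input W ω) := by
  have hB := eval_sizeBound I.size
  have hm := m_le_size (I := I)
  have hN := N_le_size (I := I)
  set B := sizeBound.eval I.size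
  rw [input_eq]
  refine bounded_ofLists (fun n => ?_) ?_ ?_
  · fin_cases n
    · change I.N ≤ B; omega
    · change I.m ≤ B; omega
  · have := size_le_self I.m
    have := size_le_self I.N
    simp only [List.forall_mem_cons, List.not_mem_nil, Nat.size_zero, Nat.zero_le,
      IsEmpty.forall_iff, implies_true, and_true]
    omega
  · simp only [List.forall_mem_cons, List.not_mem_nil, Nat.size_zero, Nat.zero_le,
      IsEmpty.forall_iff, implies_true, and_true]
    exact ⟨size_incidence_le (by omega), fun j => (size_num_le j).trans (by omega),
      fun j => (size_den_le j).trans (by omega), size_mark_le W (by omega),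
      size_bits_le ω (by omega)⟩

/-- `History` for the cover by all sets gives the bounds: the guess is at most twice the price of
all sets, the cost of mistakes is controlled by the guess, and the weights gain at most one bit per
step, over at most `fuel` steps. -/
theorem bounded_memory (W : Finset (Fin I.N)) {r : ℕ} (ω : Fin r → Bool) {n : ℕ}
    (hn : n ≤ (I.problem W.card).fuel)
    (h : (I.problem W.card).History (Finset.range I.m) (indices W) n) :
    Bounded (sizeBound.eval I.size) (I.memory W ω ((I.problem W.card).run (indices W) n)) := by
  have hB := eval_sizeBound I.size
  have hm := m_le_size (I := I)
  have hN := N_le_size (I := I)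
  have hk : W.card ≤ I.N := by simpa using Finset.card_le_univ W
  have hfuel := fuel_le W.card hk
  have hL := L_le W.card hk
  have hD := size_commonDen_le (I := I)
  have hsm := size_le_self I.m
  have hsN := size_le_self I.N
  have hsk := size_le_self W.card
  have hsL := size_le_self (I.problem W.card).L
  set B := sizeBound.eval I.size
  set P := I.problem W.card with hP
  set s := P.run (indices W) n
  have hc : ∀ j, Nat.size (P.c j) ≤ B := fun j => (size_c_le _ _).trans (by omega)
  have hβ : Nat.size s.β ≤ I.size * I.size + 2 * I.size + 3 :=
    (Nat.size_le_size h.inv.guess).trans (size_two_mul_price_le W.card)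
  have hM : Nat.size s.M ≤ B := by
    have h1 : s.M ≤ s.β * (8 * P.L + 1) := h.inv.mistakes.trans (le_of_eq (by ring))
    have h2 := (Nat.size_le_size h1).trans (size_mul_le _ _)
    have h3 := size_le_self (8 * P.L + 1)
    omega
  have hw : ∀ j < I.m, Nat.size (s.w j) ≤ I.size + (n + 1) := fun j hj => by
    refine (Nat.size_le_size (h.weight j hj)).trans ((size_mul_le _ _).trans ?_)
    refine add_le_add ?_ (le_of_eq (Nat.size_pow (n := n)))
    change Nat.size W.card ≤ _
    omega
  have hLs : Nat.size P.L ≤ B := by omega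
  have htotal : Nat.size (P.total s) ≤ B :=
    (size_sum_le (f := s.w) hm hw).trans (by omega)
  have hsel : Nat.size (P.select (indices W) s) ≤ B := by
    have h1 : P.select (indices W) s ≤ I.N := Problem.select_le _ _
    have h2 := size_le_self (P.select (indices W) s)
    omega
  have hch : ∀ u < I.N, P.cheapest u < I.m := fun u hu =>
    ((valid_problem W.card).cheapest_spec hu).1
  refine bounded_ofLists (fun n => ?_) ?_ ?_
  · fin_cases n
    · change I.N ≤ B; omega
    · change I.m ≤ B; omega
  · simp only [registers, List.forall_mem_cons, List.not_mem_nil, Nat.size_zero, Nat.zero_le,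
      IsEmpty.forall_iff, implies_true, and_true]
    exact ⟨by omega, by omega, by omega, hLs, by omega, by omega, hM, hsel, htotal⟩
  · simp only [arrays, List.forall_mem_cons, List.not_mem_nil, Nat.size_zero, Nat.zero_le,
      true_and, IsEmpty.forall_iff, implies_true, and_true]
    exact ⟨size_incidence_le (by omega), fun j => (size_num_le j).trans (by omega),
      fun j => (size_den_le j).trans (by omega), size_mark_le W (by omega),
      size_bits_le ω (by omega), size_below_le fun j _ => hc j,
      size_below_le fun u hu => (size_le_self _).trans (by
        have : (I.problem W.card).cheapest u < I.m := hch u hu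
        omega),
      size_below_le fun u _ => hc _, size_below_le fun j hj => (hw j hj).trans (by omega),
      size_below_le fun j hj => (hw j hj).trans (by omega)⟩

end SetSystem

open SetSystem

/-- The inputs of the algorithm. -/
structure Instance where
  system : SetSystem
  sample : Finset (Fin system.N)
  coins : Fin (universalAlgorithm.coins.eval system.size) → Bool

/-- The loop runs while variable 5, the selected element, is below `N`, that is, until the learner
halts. Up to then the memory follows `Problem.run`, and the halting state is `Problem.final`. -/
theorem polyTime_universalAlgorithm : universalAlgorithm.PolyTime := by
  have hhalt : ∀ x : Instance, ∃ n ≤ (x.system.problem x.sample.card).fuel,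
      x.system.N ≤ (x.system.problem x.sample.card).select (indices x.sample)
        ((x.system.problem x.sample.card).run (indices x.sample) n) ∧
      (∀ j < n, (x.system.problem x.sample.card).select (indices x.sample)
        ((x.system.problem x.sample.card).run (indices x.sample) j) < x.system.N) ∧
      (x.system.problem x.sample.card).final (indices x.sample) =
        (x.system.problem x.sample.card).run (indices x.sample) n := fun x =>
    Problem.exists_halt (valid_problem _) (indices_subset _) (log_m_le _)
  choose n hfuel hend hlt hfinal using hhalt
  have hmem : ∀ x : Instance, ∀ j ≤ n x,
      Cmd.iteration.den^[j] (Cmd.preparation.den (x.system.input x.sample x.coins)) =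
        x.system.memory x.sample x.coins
          ((x.system.problem x.sample.card).run (indices x.sample) j) := by
    intro x j
    induction j with
    | zero =>
      intro _
      rw [Function.iterate_zero_apply, den_preparation, Problem.run_zero]
    | succ j ih =>
      intro hj
      rw [Function.iterate_succ_apply', ih (by omega), den_iteration _ _ _ _ (hlt x j hj),
        Problem.run_succ]
  obtain ⟨p, hp⟩ := Cmd.exists_exec_while (fun x : Instance => x.system.size)
    (fun x => x.system.input x.sample x.coins) Cmd.wellFormed_preparation
    Cmd.wellFormed_iteration Cmd.wellFormed_rounding 5 sizeBound fuelBound n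
    (fun x => (hfuel x).trans (fuel_le _ (by simpa using Finset.card_le_univ x.sample)))
    (fun x => bounded_input _ _)
    (fun x j hj => by
      rw [hmem x j hj]
      exact bounded_memory _ _ (hj.trans (hfuel x)) (Problem.history (valid_problem _)
        ((valid_problem _).covers_range (indices_subset _)) (log_m_le _)
        fun i hi => hlt x i (by omega)))
    (fun x j hj => by rw [hmem x j hj.le]; exact hlt x j hj)
    (fun x => by rw [hmem x _ le_rfl]; exact hend x)
  refine ⟨Cmd.whileProgram Cmd.preparation Cmd.iteration Cmd.rounding 5, p, fun I W ω => ?_⟩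
  obtain ⟨t, τ, h1, h2, h3⟩ := hp ⟨I, W, ω⟩
  refine ⟨t, τ, h1, h2, fun u => ?_⟩
  rw [h3.1, hmem _ _ le_rfl, den_rounding _ _ _ _ u.2, ← hfinal]
  rfl

end SetCover

theorem mainTheorem4 :
    ∃ C : ℝ, 0 < C ∧ ∀ α : ℝ, 0 < α → α ≤ 1 →
      ∃ A : SetCover.UniversalAlgorithm, A.PolyTime ∧
        A.Competitive α (fun m n => C * max 1 (Real.log ((m : ℝ) * (n : ℝ))) / α) :=
  ⟨200, by norm_num, fun _ hα hα1 => ⟨SetCover.universalAlgorithm,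
    SetCover.polyTime_universalAlgorithm, SetCover.competitive_universalAlgorithm hα hα1⟩⟩
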